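/- Let $I\subseteq\mathbb R$ be open, let $\sigma,\mu:I\to\mathbb R$ be functions, and let $u:I\times[0,\infty)\to\mathbb R$ be a classical solution of $$u_t=\sigma(x)u_{xx}+\mu(x)u_x\qquad(x\in I,\ t>0),$$ that is, $u(x,\cdot)$ is continuous on $[0,\infty)$, the derivatives $u_t,u_x,u_{xx}$ exist on $I\times(0,\infty)$, and the equation holds there. Assume that $u_x$ and $u_{xx}$ are, locally uniformly in $x$, dominated by Laplace transformable functions of time: every $x_0\in I$ has a neighbourhood $U\subseteq I$, a number $c\in\mathbb R$ and a function $h$ with $\int_0^\infty e^{-cs}h(s)\,ds<\infty$ such that $|u_x(x,s)|\le h(s)$ and $|u_{xx}(x,s)|\le h(s)$ for all $x\in U$, $s>0$. (This covers solutions $u(x,t)=\int_I G(x,y,t)f(y)\,dy$ given by a Green function $G$ whenever they have this regularity; a Green function is not required.) For $0<\beta<1$ and $t>0$ put $$g_\beta(s;t)=\frac1{t^\beta}W_{-\beta,1-\beta}\!\left(-\frac{s}{t^\beta}\right),\qquad W_{a,b}(z)=\sum_{k=0}^\infty\frac{z^k}{k!\,\Gamma(ak+b)},\qquad u_\beta(x,t)=\int_0^\infty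 u(x,s)\,g_\beta(s;t)\,ds,$$ with $1/\Gamma=0$ at the poles of $\Gamma$; put $u_\beta(x,0)=u(x,0)$, and $u_1=u$ (for $\beta=1$ or $t=0$ the density $g_\beta(\cdot;t)$ is the Dirac mass at $t$). Let $${}_CD_t^\beta v(t)=\frac1{\Gamma(1-\beta)}\int_0^t(t-\tau)^{-\beta}v'(\tau)\,d\tau\quad(0<\beta<1),\qquad {}_CD_t^1v=v'.$$ Then: 1. For all $0<\beta<1$, $x\in I$, $t>0$, the integral that defines $u_\beta(x,t)$ converges absolutely. 2. For every $0<\beta\le1$, $u_\beta$ is a classical solution, with initial value $u_\beta(x,0)=u(x,0)$, of $${}_CD_t^\beta u_\beta=\sigma(x)\frac{\partial^2u_\beta}{\partial x^2}+\mu(x)\frac{\partial u_\beta}{\partial x}\qquad(x\in I,\ t>0);$$ that is, $u_\beta(x,\cdot)$ is continuous on $[0,\infty)$ and differentiable on $(0,\infty)$, the integral that defines the Caputo derivative converges absolutely (for $\beta<1$), $\partial_xu_\beta$ and $\partial_x^2u_\beta$ exist, and the equation holds. 3. For all $x\in I$ and $t\ge0$, $\lim_{\beta\to1^-}u_\beta(x,t)=u(x,t)$.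 -/

import Mathlib

open Set Filter Topology MeasureTheory

noncomputable section

/-- The Wright function `W_{a,b}(z) = ∑ z^k / (k! Γ(a k + b))` for real parameters and real
argument. `Real.Gamma` vanishes at the non-positive integers, so that `1 / Γ` is `0` there, as it
should be. -/
def wright (a b z : ℝ) : ℝ :=
  ∑' k : ℕ, z ^ k / ((k.factorial : ℝ) * Real.Gamma (a * k + b))

/-- The Wright type density `g_β(s;t) = t^{-β} W_{-β,1-β}(-s t^{-β})`, for `0 < β < 1`, `t > 0`. -/
def wrightDensity (β s t : ℝ) : ℝ :=
  1 / t ^ β * wright (-β) (1 - β) (-(s / t ^ β))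

/-- The Wright type transformation `f_β(t) = ∫_0^∞ f(s) g_β(s;t) ds` for `0 < β < 1`, `t > 0`.
The density `g_β(·;t)` degenerates to the Dirac mass at `t` if `β = 1` or `t = 0`, and then
`f_β(t) = f(t)`. -/
def wrightTransform (β : ℝ) (f : ℝ → ℝ) (t : ℝ) : ℝ :=
  if β = 1 ∨ t = 0 then f t else ∫ s in Ioi (0 : ℝ), f s * wrightDensity β s t

/-- The Caputo derivative `J^{1-β} D f` of order `0 < β ≤ 1`; it is `D f` if `β = 1`. -/
def caputoDeriv (β : ℝ) (f : ℝ → ℝ) (t : ℝ) : ℝ :=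
  if β = 1 then deriv f t
  else 1 / Real.Gamma (1 - β) * ∫ τ in (0 : ℝ)..t, (t - τ) ^ (-β) * deriv f τ

/-- The Caputo derivative of order `β` of `f` exists at `t > 0`: `f` is continuous on `[0,t]`,
differentiable at every point of `(0,t]`, and, if `β ≠ 1`, the integral that defines the Caputo
derivative converges absolutely. -/
structure CaputoDifferentiableAt (β : ℝ) (f : ℝ → ℝ) (t : ℝ) : Prop where
  continuousOn : ContinuousOn f (Icc 0 t)
  differentiableAt : ∀ τ ∈ Ioc 0 t, DifferentiableAt ℝ f τ
  integrable : β ≠ 1 →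
    IntervalIntegrable (fun τ => (t - τ) ^ (-β) * deriv f τ) volume 0 t

/-- The partial derivative `u_x(x,t)`. -/
def partialX (u : ℝ → ℝ → ℝ) (x t : ℝ) : ℝ :=
  deriv (fun z => u z t) x

/-- The partial derivative `u_xx(x,t)`. -/
def partialXX (u : ℝ → ℝ → ℝ) (x t : ℝ) : ℝ :=
  deriv (fun z => partialX u z t) x

/-- `u` is a classical solution of `u_t = σ(x) u_xx + μ(x) u_x` on `I × (0,∞)`, with `u(x,·)`
continuous on `[0,∞)`. -/
structure IsClassicalSolution (I : Set ℝ) (σ μ : ℝ → ℝ) (u : ℝ → ℝ → ℝ) : Prop where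
  continuousOn : ∀ x ∈ I, ContinuousOn (u x) (Ici 0)
  differentiableAt_t : ∀ x ∈ I, ∀ t > 0, DifferentiableAt ℝ (u x) t
  differentiableAt_x : ∀ x ∈ I, ∀ t > 0, DifferentiableAt ℝ (fun z => u z t) x
  differentiableAt_xx : ∀ x ∈ I, ∀ t > 0, DifferentiableAt ℝ (fun z => partialX u z t) x
  equation : ∀ x ∈ I, ∀ t > 0,
    deriv (u x) t = σ x * partialXX u x t + μ x * partialX u x t

/-- `v` is a classical solution of the time-fractional equation
`_C D_t^β v = σ(x) v_xx + μ(x) v_x` on `I × (0,∞)`, with `v(x,·)` continuous on `[0,∞)`. -/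
structure IsFractionalSolution (β : ℝ) (I : Set ℝ) (σ μ : ℝ → ℝ) (v : ℝ → ℝ → ℝ) : Prop where
  continuousOn : ∀ x ∈ I, ContinuousOn (v x) (Ici 0)
  caputoDifferentiableAt_t : ∀ x ∈ I, ∀ t > 0, CaputoDifferentiableAt β (v x) t
  differentiableAt_x : ∀ x ∈ I, ∀ t > 0, DifferentiableAt ℝ (fun z => v z t) x
  differentiableAt_xx : ∀ x ∈ I, ∀ t > 0, DifferentiableAt ℝ (fun z => partialX v z t) x
  equation : ∀ x ∈ I, ∀ t > 0,
    caputoDeriv β (v x) t = σ x * partialXX v x t + μ x * partialX v x t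

/-- Locally uniformly in `x ∈ I`, the functions `w(x,·)` are dominated on `(0,∞)` by a function
whose Laplace integral converges absolutely at some real point. -/
def LocallyLaplaceDominated (I : Set ℝ) (w : ℝ → ℝ → ℝ) : Prop :=
  ∀ x₀ ∈ I, ∃ (c : ℝ) (h : ℝ → ℝ),
    IntegrableOn (fun s => Real.exp (-c * s) * h s) (Ioi 0) ∧
      ∀ᶠ x in 𝓝 x₀, ∀ s > 0, |w x s| ≤ h s

end

/-! Write M(z) = W_{-β,1-β}(-z), so that g_β(s;t) = t^{-β} M(s t^{-β}). Everything rests on the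
companion density ℓ_s(t) = (β s / t) g_β(s;t), the one-sided β-stable density, whose Laplace
transform in t is exp(-s σ^β). Only its inverse Laplace integral is used: summing the Wright series
by means of the reflection formula gives a ray integral, which is rotated onto the imaginary axis
(`wrightAux_eq_stableHalfLine`). Moving the contour to the right shows that M decays faster than
every exponential and that ℓ_s vanishes for t ≤ 0. Integrating against x^{-β} under the contour
integral gives the Abel identity ∫_0^t (t-τ)^{-β} ℓ_s(τ) dτ = Γ(1-β) g_β(s;t)
(`integral_sub_rpow_mul_stableDensity`).

The Abel identity also yields M ≥ 0, through an extremum principle for the Caputo derivative applied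
to the primitive of ℓ_1, and ∫ M = 1, by comparing both sides as t → ∞.

At fixed x the function f = u(x,·) has f' = σ u_xx + μ u_x, which is Laplace dominated, so f grows
at most exponentially and u_β converges. Integration by parts puts t into the tail of g_β(·;t),
whose t-derivative is ℓ_s(t). Hence d/dt u_β = ∫ f'(s) ℓ_s(t) ds, and by Fubini and the Abel
identity the Caputo derivative of u_β is ∫ f'(s) g_β(s;t) ds: the transform carries d/dt to the
Caputo derivative. The x-derivatives pass under the integral by domination, so the fractional
equation is the transform of the classical one at each fixed x; no regularity of σ and μ enters.

For β → 1 the exponential moments of g_β(·;t) are Mittag-Leffler series, which tend to e^{lt}. A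
Korovkin argument with the test function (e^{ls} - e^{lt})² then gives convergence for every
continuous f of exponential growth. -/

noncomputable section

/-! ### Coefficients and convergence of the Wright series. -/

/-- Reflection formula for the coefficients of the Wright function with `b = 0`. -/
theorem inv_Gamma_neg_mul {β : ℝ} (hβ : 0 < β) (k : ℕ) :
    1 / Real.Gamma (-β * k) = -(Real.Gamma (β * k + 1) * Real.sin (Real.pi * (β * k)) / Real.pi) := by
  have h := Real.Gamma_mul_Gamma_one_sub (β * k + 1)
  have hpos : 0 < Real.Gamma (β * k + 1) := Real.Gamma_pos_of_pos (by positivity)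
  have e1 : 1 - (β * k + 1) = -β * k := by ring
  have e2 : Real.sin (Real.pi * (β * k + 1)) = -Real.sin (Real.pi * (β * k)) := by
    rw [mul_add, mul_one, Real.sin_add_pi]
  rw [e1, e2] at h
  have h' : Real.Gamma (-β * k) =
      -(Real.pi / (Real.Gamma (β * k + 1) * Real.sin (Real.pi * (β * k)))) := by
    rw [div_neg] at h
    rw [eq_comm, ← mul_right_inj' hpos.ne', h]
    rw [← div_div, mul_neg, mul_div_assoc']
    rw [mul_div_cancel₀ _ hpos.ne']
  rw [h', one_div, inv_neg, inv_div]

/-- Log-convexity of Γ: βk + 1 is the convex combination of k + 1 and 1 with weights β and 1 - β.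
Together with the reflection formula it bounds the Wright coefficients by (k!)^{β-1}. -/
theorem Gamma_mul_nat_add_one_le {β : ℝ} (hβ : 0 < β) (hβ1 : β < 1) (k : ℕ) :
    Real.Gamma (β * k + 1) ≤ (k.factorial : ℝ) ^ β := by
  have h := Real.Gamma_mul_add_mul_le_rpow_Gamma_mul_rpow_Gamma (s := (k : ℝ) + 1) (t := 1)
    (a := β) (b := 1 - β) (by positivity) one_pos hβ (by linarith) (by ring)
  rw [Real.Gamma_nat_eq_factorial, Real.Gamma_one, Real.one_rpow, mul_one, mul_one] at h
  convert h using 2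
  ring

theorem summable_pow_mul_factorial_rpow {β : ℝ} (hβ1 : β < 1) (x : ℝ) :
    Summable fun k : ℕ => x ^ k / (k.factorial : ℝ) * (k.factorial : ℝ) ^ β := by
  by_cases hx : x = 0
  · refine summable_of_ne_finset_zero (s := {0}) fun k hk => ?_
    have : k ≠ 0 := by simpa using hk
    simp [hx, this]
  refine summable_of_ratio_test_tendsto_lt_one (l := 0) one_pos ?_ ?_
  · refine Eventually.of_forall fun k => ?_
    have : (0 : ℝ) < k.factorial := by positivity
    positivity
  · have h : ∀ k : ℕ, ‖x ^ (k + 1) / ((k + 1).factorial : ℝ) * ((k + 1).factorial : ℝ) ^ β‖ /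
        ‖x ^ k / (k.factorial : ℝ) * (k.factorial : ℝ) ^ β‖ = |x| * ((k : ℝ) + 1) ^ (β - 1) := by
      intro k
      have h1 : (0 : ℝ) < k.factorial := by positivity
      have h2 : (0 : ℝ) < (k : ℝ) + 1 := by positivity
      have h3 : (0 : ℝ) < (k.factorial : ℝ) ^ β := by positivity
      rw [Nat.factorial_succ]
      push_cast
      rw [Real.mul_rpow h2.le h1.le, Real.rpow_sub_one h2.ne']
      simp only [norm_mul, norm_div, norm_pow]
      rw [Real.norm_eq_abs, Real.norm_of_nonneg h2.le, Real.norm_of_nonneg h1.le, Real.norm_of_nonneg h3.le,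
        Real.norm_of_nonneg (Real.rpow_nonneg h2.le β)]
      have : |x| ≠ 0 := abs_ne_zero.mpr hx
      field_simp
      ring
    simp_rw [h]
    rw [← mul_zero |x|]
    refine Tendsto.const_mul _ ?_
    have := (tendsto_rpow_neg_atTop (y := 1 - β) (by linarith)).comp
      (tendsto_natCast_atTop_atTop (R := ℝ) |>.atTop_add (tendsto_const_nhds (x := (1 : ℝ))))
    refine this.congr fun k => ?_
    simp [neg_sub]

/-- The auxiliary Wright function `W_{-β,0}(-z) = ∑ (-z)^k / (k! Γ(-βk))`. -/
def wrightAux (β z : ℝ) : ℝ := wright (-β) 0 (-z)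

/-- The function `M_β(z) = W_{-β,1-β}(-z)`. -/
def wrightM (β z : ℝ) : ℝ := wright (-β) (1 - β) (-z)

theorem wrightDensity_eq (β s t : ℝ) :
    wrightDensity β s t = 1 / t ^ β * wrightM β (s / t ^ β) := rfl

theorem norm_wrightAux_term_le {β : ℝ} (hβ : 0 < β) (hβ1 : β < 1) (z : ℝ) (k : ℕ) :
    ‖z ^ k / ((k.factorial : ℝ) * Real.Gamma (-β * k))‖ ≤
      |z| ^ k / (k.factorial : ℝ) * (k.factorial : ℝ) ^ β := by
  have h1 := Gamma_mul_nat_add_one_le hβ hβ1 k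
  have h0 : 0 < Real.Gamma (β * k + 1) := Real.Gamma_pos_of_pos (by positivity)
  have e : z ^ k / ((k.factorial : ℝ) * Real.Gamma (-β * k)) =
      z ^ k / (k.factorial : ℝ) * (1 / Real.Gamma (-β * k)) := by
    rw [← div_div, div_eq_mul_one_div]
  rw [e, inv_Gamma_neg_mul hβ, norm_mul, norm_div, norm_pow, norm_neg, norm_div, norm_mul,
    Real.norm_eq_abs, Real.norm_of_nonneg h0.le, Real.norm_of_nonneg (by positivity : (0:ℝ) ≤ k.factorial),
    Real.norm_of_nonneg Real.pi_pos.le]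
  gcongr
  refine (div_le_self (by positivity) ?_).trans ?_
  · linarith [Real.pi_gt_three]
  · refine (mul_le_of_le_one_right h0.le (Real.abs_sin_le_one _)).trans h1

/-- The recursion Γ(s+1) = s Γ(s) at s = -β(k+1). It makes the series of M a shifted copy of that of
W_{-β,0}, so only the latter needs estimates. -/
theorem wrightM_coeff {β : ℝ} (hβ : 0 < β) (k : ℕ) :
    1 / ((k.factorial : ℝ) * Real.Gamma (-β * k + (1 - β))) =
      -(1 / β) * (1 / (((k + 1).factorial : ℝ) * Real.Gamma (-β * (k + 1 : ℕ)))) := by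
  have h := Real.Gamma_add_one (s := -β * (k + 1 : ℕ)) (by push_cast; nlinarith)
  have e : -β * ((k + 1 : ℕ) : ℝ) + 1 = -β * k + (1 - β) := by push_cast; ring
  rw [e] at h
  rw [h, Nat.factorial_succ]
  push_cast
  simp only [one_div, mul_inv, inv_neg]
  ring

theorem norm_wrightM_term_le {β : ℝ} (hβ : 0 < β) (hβ1 : β < 1) {z R : ℝ} (hz : |z| ≤ R) (k : ℕ) :
    ‖z ^ k / ((k.factorial : ℝ) * Real.Gamma (-β * k + (1 - β)))‖ ≤
      1 / β * ((R + 1) ^ (k + 1) / ((k + 1).factorial : ℝ) * ((k + 1).factorial : ℝ) ^ β) := by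
  have hR : 0 ≤ R := (abs_nonneg z).trans hz
  have h := norm_wrightAux_term_le hβ hβ1 1 (k + 1)
  have e : z ^ k / ((k.factorial : ℝ) * Real.Gamma (-β * k + (1 - β))) =
      -(z ^ k * (1 / β) * (1 ^ (k + 1) / (((k + 1).factorial : ℝ) * Real.Gamma (-β * (k + 1 : ℕ))))) := by
    rw [div_eq_mul_one_div, wrightM_coeff hβ]
    simp
    ring
  rw [e, norm_neg, norm_mul, norm_mul, norm_pow, Real.norm_eq_abs,
    Real.norm_of_nonneg (by positivity : 0 ≤ 1 / β)]
  -- The base is R + 1 and not R so that it is at least 1 and the exponent may be raised from k to k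
  -- + 1.
  have h2 : |z| ^ k ≤ (R + 1) ^ (k + 1) :=
    (pow_le_pow_left₀ (abs_nonneg z) (hz.trans (by linarith)) k).trans
      (pow_le_pow_right₀ (by linarith) (Nat.le_succ k))
  calc |z| ^ k * (1 / β) * _ ≤ (R + 1) ^ (k + 1) * (1 / β) *
        (|1| ^ (k + 1) / ((k + 1).factorial : ℝ) * ((k + 1).factorial : ℝ) ^ β) := by gcongr
    _ = _ := by simp; ring

theorem summable_wrightM_bound {β : ℝ} (hβ1 : β < 1) (R : ℝ) : Summable fun k : ℕ =>
    1 / β * (R ^ (k + 1) / ((k + 1).factorial : ℝ) * ((k + 1).factorial : ℝ) ^ β) :=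
  ((summable_nat_add_iff 1).mpr (summable_pow_mul_factorial_rpow hβ1 R)).mul_left _

theorem continuous_wrightM {β : ℝ} (hβ : 0 < β) (hβ1 : β < 1) : Continuous (wrightM β) := by
  have : Continuous (wright (-β) (1 - β)) := by
    rw [continuous_iff_continuousAt]
    intro z
    have h : ContinuousOn (wright (-β) (1 - β)) (Metric.ball 0 (|z| + 1)) := by
      refine continuousOn_tsum (u := _) (fun k => by fun_prop)
        (summable_wrightM_bound (β := β) hβ1 (|z| + 1 + 1)) fun k x hx => ?_
      refine norm_wrightM_term_le hβ hβ1 ?_ k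
      simpa using (mem_ball_zero_iff.mp hx).le
    refine h.continuousAt (Metric.isOpen_ball.mem_nhds ?_)
    simp
  exact this.comp continuous_neg

theorem wrightM_zero (β : ℝ) : wrightM β 0 = 1 / Real.Gamma (1 - β) := by
  unfold wrightM wright
  rw [tsum_eq_single 0]
  · simp
  · intro k hk
    simp [hk]

theorem wrightAux_eq {β : ℝ} (hβ : 0 < β) (hβ1 : β < 1) (z : ℝ) :
    wrightAux β z = β * z * wrightM β z := by
  unfold wrightAux wrightM wright
  simp only [add_zero]
  have hs : Summable fun k : ℕ => (-z) ^ k / ((k.factorial : ℝ) * Real.Gamma (-β * k)) :=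
    Summable.of_norm_bounded (summable_pow_mul_factorial_rpow hβ1 |-z|)
      (norm_wrightAux_term_le hβ hβ1 (-z))
  rw [hs.tsum_eq_zero_add, ← tsum_mul_left]
  -- The constant term drops out because `Real.Gamma 0` is `0` and division by zero gives zero, in
  -- agreement with 1/Γ(0) = 0.
  simp only [Nat.cast_zero, mul_zero, Real.Gamma_zero, div_zero, zero_add]
  refine tsum_congr fun k => ?_
  rw [div_eq_mul_one_div _ ((k.factorial : ℝ) * _), wrightM_coeff hβ, pow_succ]
  field_simp

/-! ### Laplace transform of powers at complex argument. -/

theorem integrableOn_rpow_mul_exp_neg_mul {s b : ℝ} (hs : -1 < s) (hb : 0 < b) :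
    IntegrableOn (fun x : ℝ => x ^ s * Real.exp (-(b * x))) (Ioi 0) := by
  simpa using integrableOn_rpow_mul_exp_neg_mul_rpow hs one_pos hb

theorem norm_rpow_mul_cexp_neg_mul {t s : ℝ} (ht : 0 < t) (r : ℂ) :
    ‖((t ^ s : ℝ) : ℂ) * Complex.exp (-(r * t))‖ = t ^ s * Real.exp (-(r.re * t)) := by
  rw [norm_mul, Complex.norm_real, Complex.norm_exp, Real.norm_of_nonneg (by positivity)]
  simp

theorem integrableOn_rpow_mul_cexp_neg_mul {s : ℝ} {r : ℂ} (hs : -1 < s) (hr : 0 < r.re) :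
    IntegrableOn (fun t : ℝ => ((t ^ s : ℝ) : ℂ) * Complex.exp (-(r * t))) (Ioi 0) := by
  refine (integrableOn_rpow_mul_exp_neg_mul hs hr).mono' (by fun_prop) ?_
  filter_upwards [ae_restrict_mem measurableSet_Ioi] with t ht
  exact (norm_rpow_mul_cexp_neg_mul ht r).le

/-- The Laplace transform of `t ^ (s - 1)` in the right half plane. -/
theorem integral_rpow_mul_cexp_neg_mul_Ioi {s : ℝ} (hs : 0 < s) {r : ℂ} (hr : 0 < r.re) :
    ∫ t in Ioi (0 : ℝ), ((t ^ (s - 1) : ℝ) : ℂ) * Complex.exp (-(r * t)) =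
      Real.Gamma s * r ^ (-s : ℂ) := by
  set U : Set ℂ := {z | 0 < z.re} with hU
  have hUo : IsOpen U := isOpen_lt continuous_const Complex.continuous_re
  have hUc : IsPreconnected U := (convex_halfSpace_re_gt 0).isPreconnected
  have hd : DifferentiableOn ℂ (fun r : ℂ => ∫ t in Ioi (0 : ℝ), ((t ^ (s - 1) : ℝ) : ℂ) *
      Complex.exp (-(r * t))) U := by
    intro r₀ hr₀
    have hr₀' : 0 < r₀.re := hr₀
    refine DifferentiableAt.differentiableWithinAt ?_
    have hnb : {z : ℂ | r₀.re / 2 < z.re} ∈ 𝓝 r₀ :=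
      (isOpen_lt continuous_const Complex.continuous_re).mem_nhds (by simpa using hr₀')
    refine (hasDerivAt_integral_of_dominated_loc_of_deriv_le (μ := volume.restrict (Ioi (0 : ℝ)))
      (F' := fun r (t : ℝ) => ((t ^ (s - 1) : ℝ) : ℂ) * (Complex.exp (-(r * t)) * -t))
      (bound := fun t : ℝ => t ^ s * Real.exp (-(r₀.re / 2 * t))) hnb ?_ ?_ ?_ ?_ ?_ ?_).2.differentiableAt
    · exact Eventually.of_forall fun z => by fun_prop
    · exact integrableOn_rpow_mul_cexp_neg_mul (by linarith) hr₀
    · fun_prop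
    · filter_upwards [ae_restrict_mem measurableSet_Ioi] with t ht z hz
      have ht' : 0 < t := ht
      rw [← mul_assoc, norm_mul, norm_rpow_mul_cexp_neg_mul ht, norm_neg, Complex.norm_real,
        Real.norm_of_nonneg ht'.le, mul_right_comm, ← Real.rpow_add_one ht'.ne', sub_add_cancel]
      have hz' : r₀.re / 2 < z.re := hz
      gcongr
    · exact integrableOn_rpow_mul_exp_neg_mul (by linarith) (half_pos hr₀')
    · filter_upwards with t z _
      refine HasDerivAt.const_mul _ ?_
      refine HasDerivAt.cexp ?_
      simpa using ((hasDerivAt_id z).mul_const (t : ℂ)).fun_neg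
  have hd2 : DifferentiableOn ℂ (fun r : ℂ => (Real.Gamma s : ℂ) * r ^ (-s : ℂ)) U := by
    intro z hz
    refine ((differentiableAt_id.cpow_const ?_).const_mul _).differentiableWithinAt
    exact Or.inl hz
  have h1 : (1 : ℂ) ∈ U := by simp [hU]
  -- Identity theorem: both sides are holomorphic in the half plane and agree at the real points r >
  -- 1, which accumulate at 1.
  refine AnalyticOnNhd.eqOn_of_preconnected_of_frequently_eq (hd.analyticOnNhd hUo)
    (hd2.analyticOnNhd hUo) hUc h1 ?_ hr
  have ht : Tendsto (fun x : ℝ => (x : ℂ)) (𝓝[>] 1) (𝓝[≠] 1) := by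
    refine tendsto_nhdsWithin_iff.mpr ⟨?_, ?_⟩
    · have : Tendsto (fun x : ℝ => (x : ℂ)) (𝓝 1) (𝓝 1) := by
        simpa using Complex.continuous_ofReal.tendsto 1
      exact this.mono_left nhdsWithin_le_nhds
    · filter_upwards [self_mem_nhdsWithin] with x hx
      have : x ≠ 1 := ne_of_gt hx
      simpa using this
  refine ht.frequently (Eventually.frequently ?_)
  filter_upwards [self_mem_nhdsWithin] with x hx
  have hx0 : 0 < x := lt_trans one_pos hx
  have h := Real.integral_rpow_mul_exp_neg_mul_Ioi hs hx0
  have e : ∀ t : ℝ, ((t ^ (s - 1) : ℝ) : ℂ) * Complex.exp (-((x : ℂ) * t)) =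
      ((t ^ (s - 1) * Real.exp (-(x * t)) : ℝ) : ℂ) := by
    intro t; push_cast; rfl
  simp_rw [e]
  rw [integral_complex_ofReal, h, one_div, Real.inv_rpow hx0.le, ← Real.rpow_neg hx0.le]
  push_cast [Complex.ofReal_cpow hx0.le]
  ring

/-! ### From the Wright series to an inverse Laplace integral. -/

theorem cexp_neg_mul_I_re (φ : ℝ) : (Complex.exp (-(φ * Complex.I))).re = Real.cos φ := by
  have : -(φ * Complex.I) = ((-φ : ℝ) : ℂ) * Complex.I := by push_cast; ring
  rw [this, Complex.exp_ofReal_mul_I_re, Real.cos_neg]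

theorem cexp_neg_mul_I_cpow {φ : ℝ} (h0 : 0 < φ) (h1 : φ < Real.pi / 2) (x : ℂ) :
    Complex.exp (-(φ * Complex.I)) ^ x = Complex.exp (-(φ * Complex.I) * x) := by
  have hpi := Real.pi_pos
  rw [Complex.cpow_def_of_ne_zero (Complex.exp_ne_zero _), Complex.log_exp]
  · simp; linarith
  · simp; linarith

/-- The Wright function as an integral along the ray with argument `π - φ`. -/
theorem wrightAux_eq_ray {β : ℝ} (hβ : 0 < β) (hβ1 : β < 1) (z : ℝ) {φ : ℝ} (h0 : 0 < φ)
    (h1 : φ < Real.pi / 2) :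
    wrightAux β z = -(1 / Real.pi) * (Complex.exp (-(φ * Complex.I)) *
      ∫ r in Ioi (0 : ℝ), Complex.exp (-(Complex.exp (-(φ * Complex.I)) * r) +
        -z * Complex.exp (β * (Real.pi - φ) * Complex.I) * ((r ^ β : ℝ) : ℂ))).im := by
  set ρ := Complex.exp (-(φ * Complex.I)) with hρ
  set ω := Complex.exp (β * (Real.pi - φ) * Complex.I) with hω
  have hcos : 0 < Real.cos φ := Real.cos_pos_of_mem_Ioo ⟨by linarith, h1⟩
  have hρre : 0 < ρ.re := by rw [hρ, cexp_neg_mul_I_re]; exact hcos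
  have hωn : ‖ω‖ = 1 := by
    have : (β * (Real.pi - φ) * Complex.I : ℂ) = ((β * (Real.pi - φ) : ℝ) : ℂ) * Complex.I := by
      push_cast; ring
    rw [hω, this, Complex.norm_exp_ofReal_mul_I]
  -- Expand the exponential of -zωr^β and integrate term by term. The condition φ < π/2 gives Re ρ >
  -- 0, hence absolute convergence of the interchange.
  let F : ℕ → ℝ → ℂ := fun k r => (-z * ω) ^ k / (k.factorial : ℂ) *
    (((r ^ (β * k) : ℝ) : ℂ) * Complex.exp (-(ρ * r)))
  have hk0 : ∀ k : ℕ, -1 < β * (k : ℝ) := fun k => by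
    have : 0 ≤ β * (k : ℝ) := by positivity
    linarith
  have hFi : ∀ k, Integrable (F k) (volume.restrict (Ioi 0)) := fun k =>
    (integrableOn_rpow_mul_cexp_neg_mul (hk0 k) hρre).const_mul _
  have hFn : ∀ k, ∫ r in Ioi (0 : ℝ), ‖F k r‖ = |z| ^ k / (k.factorial : ℝ) *
      ((1 / ρ.re) ^ (β * k + 1) * Real.Gamma (β * k + 1)) := by
    intro k
    have h := Real.integral_rpow_mul_exp_neg_mul_Ioi (a := β * k + 1) (r := ρ.re)
      (by positivity) hρre
    rw [← h, ← integral_const_mul]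
    refine setIntegral_congr_fun measurableSet_Ioi fun r hr => ?_
    have hr' : 0 < r := hr
    simp only [F]
    rw [norm_mul, norm_rpow_mul_cexp_neg_mul hr']
    simp [hωn]
  have hsum : Summable fun k => ∫ r in Ioi (0 : ℝ), ‖F k r‖ := by
    simp_rw [hFn]
    refine Summable.of_nonneg_of_le (fun k => ?_) (fun k => ?_)
      ((summable_pow_mul_factorial_rpow hβ1 (|z| * (1 / ρ.re) ^ β)).mul_left (1 / ρ.re))
    · have : 0 < Real.Gamma (β * k + 1) := Real.Gamma_pos_of_pos (by positivity)
      positivity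
    · have h := Gamma_mul_nat_add_one_le hβ hβ1 k
      have e : (1 / ρ.re) ^ (β * k + 1) = ((1 / ρ.re) ^ β) ^ k * (1 / ρ.re) := by
        rw [Real.rpow_add_one (by positivity), Real.rpow_mul (by positivity), Real.rpow_natCast]
      rw [e, mul_pow]
      calc _ ≤ |z| ^ k / (k.factorial : ℝ) *
            (((1 / ρ.re) ^ β) ^ k * (1 / ρ.re) * (k.factorial : ℝ) ^ β) := by gcongr
        _ = _ := by ring
  have hS := hasSum_integral_of_summable_integral_norm hFi hsum
  have hint : ∫ r in Ioi (0 : ℝ), ∑' k, F k r = ∫ r in Ioi (0 : ℝ),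
      Complex.exp (-(ρ * r) + -z * ω * ((r ^ β : ℝ) : ℂ)) := by
    refine setIntegral_congr_fun measurableSet_Ioi fun r hr => ?_
    have hr' : 0 < r := hr
    have h := (NormedSpace.expSeries_div_hasSum_exp (-z * ω * ((r ^ β : ℝ) : ℂ))).mul_right
      (Complex.exp (-(ρ * r)))
    rw [← Complex.exp_eq_exp_ℂ] at h
    rw [Complex.exp_add, mul_comm (Complex.exp _), ← h.tsum_eq]
    refine tsum_congr fun k => ?_
    simp only [F]
    rw [Real.rpow_mul hr'.le, Real.rpow_natCast, mul_pow (-z * ω)]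
    push_cast
    ring
  rw [hint] at hS
  have hS2 := hS.mul_left ρ
  -- The phases of ρ and ω combine to e^{iπβk}, independently of φ; its imaginary part is the sine
  -- in the reflection formula.
  have hterm : ∀ k : ℕ, ρ * ∫ r in Ioi (0 : ℝ), F k r =
      (((-z) ^ k / (k.factorial : ℝ) * Real.Gamma (β * k + 1) : ℝ) : ℂ) *
        Complex.exp (((Real.pi * (β * k) : ℝ) : ℂ) * Complex.I) := by
    intro k
    have h := integral_rpow_mul_cexp_neg_mul_Ioi (s := β * k + 1) (by positivity) hρre
    simp only [add_sub_cancel_right] at h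
    simp only [F]
    rw [integral_const_mul, h, hρ, cexp_neg_mul_I_cpow h0 h1, mul_pow, hω, ← Complex.exp_nat_mul]
    push_cast
    rw [show (Real.pi : ℂ) * (β * k) * Complex.I = -(φ * Complex.I) +
      (k * (β * (Real.pi - φ) * Complex.I) + -(φ * Complex.I) * -(β * k + 1)) by ring,
      Complex.exp_add, Complex.exp_add]
    ring
  have hS3 := Complex.hasSum_im hS2
  rw [← hS3.tsum_eq, ← tsum_mul_left]
  unfold wrightAux wright
  refine tsum_congr fun k => ?_
  rw [hterm k, Complex.im_ofReal_mul, Complex.exp_ofReal_mul_I_im, add_zero, ← div_div, div_eq_mul_one_div _ (Real.Gamma _), inv_Gamma_neg_mul hβ]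
  ring

/-- The integrand `exp (σ t - z σ ^ β)` of the inverse Laplace transform. -/
def stableKernel (β z t : ℝ) (σ : ℂ) : ℂ := Complex.exp (σ * t - z * σ ^ (β : ℂ))

/-- The integral of `stableKernel` over the upper half of the line `Re σ = a`. -/
def stableHalfLine (β z t a : ℝ) : ℂ :=
  ∫ y in Ioi (0 : ℝ), stableKernel β z t (a + y * Complex.I)

theorem cos_mul_pi_div_two_pos {β : ℝ} (hβ : 0 < β) (hβ1 : β < 1) :
    0 < Real.cos (β * (Real.pi / 2)) := by
  have := Real.pi_pos
  refine Real.cos_pos_of_mem_Ioo ⟨by nlinarith, by nlinarith⟩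

/-- In the closed right half plane the argument of σ^β is at most βπ/2 < π/2 in absolute value. This
gap is the source of all the decay below. -/
theorem cos_mul_norm_rpow_le_re_cpow {β : ℝ} (hβ : 0 < β) (hβ1 : β < 1) {σ : ℂ} (hσ : 0 ≤ σ.re) :
    Real.cos (β * (Real.pi / 2)) * ‖σ‖ ^ β ≤ (σ ^ (β : ℂ)).re := by
  rw [Complex.cpow_ofReal_re, mul_comm]
  refine mul_le_mul_of_nonneg_left ?_ (by positivity)
  rw [← Real.cos_abs (σ.arg * β)]
  have h := Complex.abs_arg_le_pi_div_two_iff.mpr hσ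
  have := Real.pi_pos
  refine Real.cos_le_cos_of_nonneg_of_le_pi (abs_nonneg _) (by nlinarith) ?_
  rw [abs_mul, abs_of_pos hβ, mul_comm]
  gcongr

/-- Both a^β and y^β are at most |σ|^β, so half of the decay is spent on each: the y-half gives
integrability along the line, the a-half rewards moving the line to the right. -/
theorem norm_stableKernel_le {β : ℝ} (hβ : 0 < β) (hβ1 : β < 1) {z a y : ℝ} (t : ℝ) (hz : 0 ≤ z)
    (ha : 0 ≤ a) (hy : 0 ≤ y) :
    ‖stableKernel β z t (a + y * Complex.I)‖ ≤
      Real.exp (a * t) * Real.exp (-(z * Real.cos (β * (Real.pi / 2)) / 2 * a ^ β)) *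
        Real.exp (-(z * Real.cos (β * (Real.pi / 2)) / 2 * y ^ β)) := by
  have hc := cos_mul_pi_div_two_pos hβ hβ1
  set c := Real.cos (β * (Real.pi / 2))
  set σ : ℂ := a + y * Complex.I with hσ
  have hre : σ.re = a := by simp [hσ]
  have him : σ.im = y := by simp [hσ]
  have h := cos_mul_norm_rpow_le_re_cpow hβ hβ1 (σ := σ) (by rw [hre]; exact ha)
  have h1 : a ^ β ≤ ‖σ‖ ^ β := by
    gcongr
    exact (le_of_eq hre.symm).trans (Complex.re_le_norm σ)
  have h2 : y ^ β ≤ ‖σ‖ ^ β := by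
    gcongr
    exact (le_of_eq him.symm).trans (Complex.im_le_norm σ)
  rw [stableKernel, Complex.norm_exp, ← Real.exp_add, ← Real.exp_add]
  refine Real.exp_le_exp.mpr ?_
  have e : (σ * t - z * σ ^ (β : ℂ)).re = a * t - z * (σ ^ (β : ℂ)).re := by
    simp [hre]
  rw [e]
  have h3 : z * (c * ‖σ‖ ^ β) ≤ z * (σ ^ (β : ℂ)).re := mul_le_mul_of_nonneg_left h hz
  have h4 : z * c * a ^ β ≤ z * c * ‖σ‖ ^ β := by gcongr
  have h5 : z * c * y ^ β ≤ z * c * ‖σ‖ ^ β := by gcongr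
  linarith

theorem integrableOn_exp_neg_mul_rpow {β b : ℝ} (hβ : 0 < β) (hb : 0 < b) :
    IntegrableOn (fun y : ℝ => Real.exp (-(b * y ^ β))) (Ioi 0) := by
  simpa using integrableOn_rpow_mul_exp_neg_mul_rpow (s := 0) (by norm_num) hβ hb

@[fun_prop]
theorem measurable_stableKernel (β z t : ℝ) : Measurable (stableKernel β z t) := by
  unfold stableKernel
  fun_prop

theorem integrableOn_stableKernel {β : ℝ} (hβ : 0 < β) (hβ1 : β < 1) {z a : ℝ} (t : ℝ) (hz : 0 < z)
    (ha : 0 ≤ a) :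
    IntegrableOn (fun y : ℝ => stableKernel β z t (a + y * Complex.I)) (Ioi 0) := by
  have hc := cos_mul_pi_div_two_pos hβ hβ1
  refine ((integrableOn_exp_neg_mul_rpow hβ (b := z * Real.cos (β * (Real.pi / 2)) / 2)
    (by positivity)).const_mul (Real.exp (a * t) *
      Real.exp (-(z * Real.cos (β * (Real.pi / 2)) / 2 * a ^ β)))).mono' ?_ ?_
  · exact Measurable.aestronglyMeasurable (by fun_prop)
  · filter_upwards [ae_restrict_mem measurableSet_Ioi] with y hy
    exact norm_stableKernel_le hβ hβ1 t hz.le ha (le_of_lt hy)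

theorem norm_stableHalfLine_le {β : ℝ} (hβ : 0 < β) (hβ1 : β < 1) {z a : ℝ} (t : ℝ) (hz : 0 < z)
    (ha : 0 ≤ a) :
    ‖stableHalfLine β z t a‖ ≤
      Real.exp (a * t) * Real.exp (-(z * Real.cos (β * (Real.pi / 2)) / 2 * a ^ β)) *
        ∫ y in Ioi (0 : ℝ), Real.exp (-(z * Real.cos (β * (Real.pi / 2)) / 2 * y ^ β)) := by
  have hc := cos_mul_pi_div_two_pos hβ hβ1
  rw [← integral_const_mul]
  refine norm_integral_le_of_norm_le ((integrableOn_exp_neg_mul_rpow hβ (by positivity)).const_mul _) ?_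
  filter_upwards [ae_restrict_mem measurableSet_Ioi] with y hy
  exact norm_stableKernel_le hβ hβ1 t hz.le ha (le_of_lt hy)

theorem ofReal_mul_I_cpow {y : ℝ} (hy : 0 < y) (β : ℝ) :
    (y * Complex.I : ℂ) ^ (β : ℂ) =
      ((y ^ β : ℝ) : ℂ) * Complex.exp (β * (Real.pi / 2) * Complex.I) := by
  have h1 : Complex.log (y * Complex.I) = Real.log y + Real.pi / 2 * Complex.I := by
    rw [Complex.log_ofReal_mul hy Complex.I_ne_zero, Complex.log_I]
  rw [Complex.cpow_def_of_ne_zero (by simp [hy.ne']), h1, add_mul, Complex.exp_add,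
    Real.rpow_def_of_pos hy]
  push_cast
  congr 2
  ring

/-- Let φ ↑ π/2 in the ray representation: the ray becomes the imaginary axis. The damping by e^{-r
cos φ} is lost in the limit, but the factor involving r^β keeps an integrable majorant, since
cos(β(π-φ)) tends to cos(βπ/2) > 0. -/
theorem wrightAux_eq_stableHalfLine_one {β : ℝ} (hβ : 0 < β) (hβ1 : β < 1) {z : ℝ} (hz : 0 < z) :
    wrightAux β z = 1 / Real.pi * (stableHalfLine β z 1 0).re := by
  have hpi := Real.pi_pos
  have hc := cos_mul_pi_div_two_pos hβ hβ1
  set c := Real.cos (β * (Real.pi / 2)) with hcdef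
  let G : ℝ → ℝ → ℂ := fun φ r => Complex.exp (-(Complex.exp (-(φ * Complex.I)) * r) +
        -z * Complex.exp (β * (Real.pi - φ) * Complex.I) * ((r ^ β : ℝ) : ℂ))
  have hGc : ∀ r, Continuous fun φ => G φ r := fun r => by fun_prop
  have hev : ∀ᶠ φ in 𝓝[<] (Real.pi / 2), c / 2 < Real.cos (β * (Real.pi - φ)) := by
    have hcont : ContinuousAt (fun φ => Real.cos (β * (Real.pi - φ))) (Real.pi / 2) := by fun_prop
    refine (hcont.eventually_const_lt ?_).filter_mono nhdsWithin_le_nhds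
    have : β * (Real.pi - Real.pi / 2) = β * (Real.pi / 2) := by ring
    simp only [this]
    linarith
  have hev0 : ∀ᶠ φ in 𝓝[<] (Real.pi / 2), φ ∈ Ioo 0 (Real.pi / 2) :=
    Ioo_mem_nhdsLT (by positivity)
  have hlim : Tendsto (fun φ => ∫ r in Ioi (0 : ℝ), G φ r) (𝓝[<] (Real.pi / 2))
      (𝓝 (∫ r in Ioi (0 : ℝ), G (Real.pi / 2) r)) := by
    refine tendsto_integral_filter_of_dominated_convergence
      (fun r => Real.exp (-(z * (c / 2) * r ^ β))) ?_ ?_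
      (integrableOn_exp_neg_mul_rpow hβ (by positivity)) ?_
    · exact Eventually.of_forall fun φ => Measurable.aestronglyMeasurable (by fun_prop)
    · filter_upwards [hev, hev0] with φ h1 h0
      filter_upwards [ae_restrict_mem measurableSet_Ioi] with r hr
      have hr' : 0 < r := hr
      simp only [G]
      rw [Complex.norm_exp]
      refine Real.exp_le_exp.mpr ?_
      have hcos : 0 < Real.cos φ := Real.cos_pos_of_mem_Ioo ⟨by linarith [h0.1], h0.2⟩
      have e1 : (-(Complex.exp (-(φ * Complex.I)) * r) +
          -z * Complex.exp (β * (Real.pi - φ) * Complex.I) * ((r ^ β : ℝ) : ℂ)).re =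
          -(Real.cos φ * r) - z * Real.cos (β * (Real.pi - φ)) * r ^ β := by
        have : (β * (Real.pi - φ) * Complex.I : ℂ) = ((β * (Real.pi - φ) : ℝ) : ℂ) * Complex.I := by
          push_cast; ring
        rw [this, Complex.add_re, Complex.neg_re, Complex.re_mul_ofReal, Complex.re_mul_ofReal,
          cexp_neg_mul_I_re, ← Complex.ofReal_neg, Complex.re_ofReal_mul,
          Complex.exp_ofReal_mul_I_re]
        ring
      rw [e1]
      have h3 : z * (c / 2) * r ^ β ≤ z * Real.cos (β * (Real.pi - φ)) * r ^ β := by gcongr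
      have h4 : 0 < Real.cos φ * r := by positivity
      linarith
    · exact Eventually.of_forall fun r => (hGc r).continuousAt.continuousWithinAt
  have hlim2 : Tendsto (fun φ : ℝ => -(1 / Real.pi) * (Complex.exp (-(φ * Complex.I)) *
      ∫ r in Ioi (0 : ℝ), G φ r).im) (𝓝[<] (Real.pi / 2))
      (𝓝 (-(1 / Real.pi) * (Complex.exp (-((Real.pi / 2 : ℝ) * Complex.I)) *
        ∫ r in Ioi (0 : ℝ), G (Real.pi / 2) r).im)) := by
    refine Tendsto.const_mul _ ((Complex.continuous_im.tendsto _).comp (Tendsto.mul ?_ hlim))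
    have : Continuous fun φ : ℝ => Complex.exp (-(φ * Complex.I)) := by fun_prop
    exact this.continuousAt.continuousWithinAt
  have hconst : Tendsto (fun φ : ℝ => -(1 / Real.pi) * (Complex.exp (-(φ * Complex.I)) *
      ∫ r in Ioi (0 : ℝ), G φ r).im) (𝓝[<] (Real.pi / 2)) (𝓝 (wrightAux β z)) := by
    refine tendsto_const_nhds.congr' ?_
    filter_upwards [hev0] with φ h0
    exact wrightAux_eq_ray hβ hβ1 z h0.1 h0.2
  rw [tendsto_nhds_unique hconst hlim2]
  have e2 : Complex.exp (-((Real.pi / 2 : ℝ) * Complex.I)) = -Complex.I := by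
    rw [Complex.exp_neg]
    push_cast
    rw [Complex.exp_pi_div_two_mul_I, Complex.inv_I]
  have e3 : ∫ r in Ioi (0 : ℝ), G (Real.pi / 2) r = stableHalfLine β z 1 0 := by
    refine setIntegral_congr_fun measurableSet_Ioi fun r hr => ?_
    simp only [G, stableKernel]
    rw [e2, Complex.ofReal_zero, zero_add, ofReal_mul_I_cpow hr]
    congr 1
    push_cast
    rw [show (Real.pi : ℂ) - Real.pi / 2 = Real.pi / 2 by ring]
    ring
  rw [e2, e3]
  simp

/-- Inverse Laplace representation of the one-sided stable density on the imaginary axis. -/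
theorem wrightAux_eq_stableHalfLine {β : ℝ} (hβ : 0 < β) (hβ1 : β < 1) {z t : ℝ} (hz : 0 < z)
    (ht : 0 < t) :
    t⁻¹ * wrightAux β (z / t ^ β) = 1 / Real.pi * (stableHalfLine β z t 0).re := by
  rw [wrightAux_eq_stableHalfLine_one hβ hβ1 (by positivity)]
  have h := integral_comp_mul_left_Ioi
    (fun y : ℝ => stableKernel β (z / t ^ β) 1 ((0 : ℝ) + y * Complex.I)) 0 ht
  have e : stableHalfLine β z t 0 = t⁻¹ • stableHalfLine β (z / t ^ β) 1 0 := by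
    rw [mul_zero] at h
    unfold stableHalfLine
    rw [← h]
    refine setIntegral_congr_fun measurableSet_Ioi fun y hy => ?_
    have hy' : 0 < y := hy
    simp only [stableKernel, Complex.ofReal_zero, zero_add]
    rw [ofReal_mul_I_cpow hy', ofReal_mul_I_cpow (mul_pos ht hy'), Real.mul_rpow ht.le hy'.le]
    have : ((t ^ β : ℝ) : ℂ) ≠ 0 := by
      exact_mod_cast (Real.rpow_pos_of_pos ht β).ne'
    congr 1
    push_cast
    field_simp
  rw [e, Complex.smul_re, smul_eq_mul]
  ring

/-! ### Contour shift: the stable density and the decay of M. -/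

theorem stableKernel_ofReal_im {β z t x : ℝ} (hx : 0 ≤ x) : (stableKernel β z t x).im = 0 := by
  have : stableKernel β z t x = ((Real.exp (x * t - z * x ^ β) : ℝ) : ℂ) := by
    rw [stableKernel, ← Complex.ofReal_cpow hx]
    push_cast
    rfl
  rw [this, Complex.ofReal_im]

theorem continuousAt_stableKernel {β : ℝ} (hβ : 0 < β) (z t : ℝ) {σ : ℂ} (hσ : 0 ≤ σ.re) :
    ContinuousAt (stableKernel β z t) σ := by
  have h : ContinuousAt (fun σ : ℂ => σ ^ (β : ℂ)) σ :=
    Complex.continuousAt_cpow_const_of_re_pos (Or.inl hσ) (by simpa using hβ)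
  unfold stableKernel
  fun_prop

theorem hasDerivAt_stableKernel (β z t : ℝ) {σ : ℂ} (hσ : 0 < σ.re) :
    HasDerivAt (stableKernel β z t)
      (stableKernel β z t σ * (t - z * (β * σ ^ ((β : ℂ) - 1)))) σ := by
  have h := (hasDerivAt_id σ).cpow_const (c := (β : ℂ)) (Or.inl hσ)
  simp only [id, mul_one] at h
  refine HasDerivAt.cexp ?_
  have h1 : HasDerivAt (fun σ : ℂ => σ * t) (t : ℂ) σ := by
    simpa using (hasDerivAt_id σ).mul_const (t : ℂ)
  exact h1.sub (h.const_mul (z : ℂ))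

/-- Cauchy's theorem on the rectangle with corners 0 and a + iR. The kernel is real on the bottom
side, so the imaginary part of the contour identity involves only the real parts of the vertical
integrals and the top side, which vanishes as R → ∞. The full complex half-line integrals need not
agree. -/
theorem stableHalfLine_re_eq {β : ℝ} (hβ : 0 < β) (hβ1 : β < 1) {z a : ℝ} (t : ℝ) (hz : 0 < z)
    (ha : 0 < a) :
    (stableHalfLine β z t 0).re = (stableHalfLine β z t a).re := by
  have hc := cos_mul_pi_div_two_pos hβ hβ1
  set c := Real.cos (β * (Real.pi / 2)) with hcdef
  have hrect : ∀ R : ℝ, 0 < R →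
      (∫ y in (0 : ℝ)..R, stableKernel β z t (a + y * Complex.I)).re -
        (∫ y in (0 : ℝ)..R, stableKernel β z t ((0 : ℝ) + y * Complex.I)).re =
      (∫ x in (0 : ℝ)..a, stableKernel β z t (x + R * Complex.I)).im := by
    intro R hR
    -- The branch point of σ^β is a corner of the rectangle, hence the version that asks for
    -- differentiability only in the interior.
    have h := Complex.integral_boundary_rect_eq_zero_of_continuousOn_of_differentiableOn
      (stableKernel β z t) 0 (a + R * Complex.I) ?_ ?_
    · simp only [Complex.zero_re, Complex.zero_im, Complex.ofReal_zero, zero_mul, add_zero,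
        Complex.add_re, Complex.add_im, Complex.ofReal_re, Complex.ofReal_im, Complex.mul_re,
        Complex.mul_im, Complex.I_re, Complex.I_im, mul_zero, mul_one, sub_zero, zero_add] at h
      have him := congrArg Complex.im h
      simp only [Complex.sub_im, Complex.add_im, smul_eq_mul, Complex.mul_im, Complex.I_re,
        Complex.I_im, zero_mul, one_mul, zero_add, Complex.zero_im] at him
      have h0 : (∫ x in (0 : ℝ)..a, stableKernel β z t x).im = 0 := by
        have e : ∫ x in (0 : ℝ)..a, stableKernel β z t x =
            ∫ x in (0 : ℝ)..a, (((stableKernel β z t x).re : ℝ) : ℂ) := by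
          refine intervalIntegral.integral_congr fun x hx => ?_
          rw [uIcc_of_le ha.le] at hx
          refine Complex.ext (by simp) ?_
          rw [Complex.ofReal_im, stableKernel_ofReal_im hx.1]
        rw [e, intervalIntegral.integral_ofReal, Complex.ofReal_im]
      simp only [Complex.ofReal_zero, zero_add]
      linarith
    · intro σ hσ
      refine (continuousAt_stableKernel hβ z t ?_).continuousWithinAt
      have := hσ.1
      simp [uIcc_of_le ha.le] at this
      exact this.1
    · intro σ hσ
      refine (hasDerivAt_stableKernel β z t ?_).differentiableAt.differentiableWithinAt
      have := hσ.1
      simp [ha.le] at this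
      exact this.1
  have htop : Tendsto (fun R : ℝ => (∫ x in (0 : ℝ)..a, stableKernel β z t (x + R * Complex.I)).im)
      atTop (𝓝 0) := by
    have hb : ∀ R : ℝ, 0 < R → ‖∫ x in (0 : ℝ)..a, stableKernel β z t (x + R * Complex.I)‖ ≤
        (Real.exp (a * |t|) * Real.exp (-(z * c / 2 * R ^ β))) * |a - 0| := by
      intro R hR
      refine intervalIntegral.norm_integral_le_of_norm_le_const fun x hx => ?_
      rw [uIoc_of_le ha.le] at hx
      refine (norm_stableKernel_le hβ hβ1 t hz.le hx.1.le hR.le).trans ?_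
      have h1 : x * t ≤ a * |t| := by
        have := hx.1.le
        have := hx.2
        have := le_abs_self t
        have := abs_nonneg t
        nlinarith
      have h2 : Real.exp (-(z * c / 2 * x ^ β)) ≤ 1 := by
        rw [Real.exp_le_one_iff]
        have := Real.rpow_nonneg hx.1.le β
        have : 0 ≤ z * c / 2 * x ^ β := by positivity
        linarith
      have h3 : 0 < Real.exp (-(z * c / 2 * R ^ β)) := Real.exp_pos _
      calc _ ≤ Real.exp (a * |t|) * 1 * Real.exp (-(z * c / 2 * R ^ β)) := by gcongr
        _ = _ := by ring
    have hlim : Tendsto (fun R : ℝ => (Real.exp (a * |t|) * Real.exp (-(z * c / 2 * R ^ β))) * |a - 0|)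
        atTop (𝓝 0) := by
      have h1 : Tendsto (fun R : ℝ => -(z * c / 2 * R ^ β)) atTop atBot :=
        tendsto_neg_atTop_atBot.comp ((tendsto_rpow_atTop hβ).const_mul_atTop (by positivity))
      have := ((Real.tendsto_exp_atBot.comp h1).const_mul (Real.exp (a * |t|))).mul_const |a - 0|
      simpa using this
    refine squeeze_zero_norm' ?_ hlim
    filter_upwards [eventually_gt_atTop 0] with R hR
    exact (Complex.abs_im_le_norm _).trans (hb R hR)
  have hI : ∀ b : ℝ, 0 ≤ b → Tendsto (fun R : ℝ =>
      (∫ y in (0 : ℝ)..R, stableKernel β z t (b + y * Complex.I)).re) atTop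
      (𝓝 (stableHalfLine β z t b).re) := fun b hb =>
    (Complex.continuous_re.tendsto _).comp (intervalIntegral_tendsto_integral_Ioi 0
      (integrableOn_stableKernel hβ hβ1 t hz hb) tendsto_id)
  have hdiff := (hI a ha.le).sub (hI 0 le_rfl)
  have := tendsto_nhds_unique (hdiff.congr' (by
    filter_upwards [eventually_gt_atTop 0] with R hR using hrect R hR)) htop
  linarith

/-- The one-sided stable density `ℓ_z(t)`, extended by `0` to `t ≤ 0`. -/
def stableDensity (β z t : ℝ) : ℝ := 1 / Real.pi * (stableHalfLine β z t 0).re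

theorem stableDensity_eq_halfLine {β : ℝ} (hβ : 0 < β) (hβ1 : β < 1) {z a : ℝ} (t : ℝ) (hz : 0 < z)
    (ha : 0 < a) : stableDensity β z t = 1 / Real.pi * (stableHalfLine β z t a).re := by
  rw [stableDensity, stableHalfLine_re_eq hβ hβ1 t hz ha]

theorem stableDensity_eq_wrightAux {β : ℝ} (hβ : 0 < β) (hβ1 : β < 1) {z t : ℝ} (hz : 0 < z)
    (ht : 0 < t) : stableDensity β z t = t⁻¹ * wrightAux β (z / t ^ β) :=
  (wrightAux_eq_stableHalfLine hβ hβ1 hz ht).symm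

theorem stableDensity_eq_wrightDensity {β : ℝ} (hβ : 0 < β) (hβ1 : β < 1) {z t : ℝ} (hz : 0 < z)
    (ht : 0 < t) : stableDensity β z t = β * z / t * wrightDensity β z t := by
  rw [stableDensity_eq_wrightAux hβ hβ1 hz ht, wrightAux_eq hβ hβ1, wrightDensity_eq]
  field_simp

theorem abs_stableDensity_le {β : ℝ} (hβ : 0 < β) (hβ1 : β < 1) {z a : ℝ} (t : ℝ) (hz : 0 < z)
    (ha : 0 < a) :
    |stableDensity β z t| ≤ 1 / Real.pi * (Real.exp (a * t) *
      Real.exp (-(z * Real.cos (β * (Real.pi / 2)) / 2 * a ^ β)) *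
        ∫ y in Ioi (0 : ℝ), Real.exp (-(z * Real.cos (β * (Real.pi / 2)) / 2 * y ^ β))) := by
  rw [stableDensity_eq_halfLine hβ hβ1 t hz ha, abs_mul, abs_of_pos (by positivity)]
  gcongr
  exact (Complex.abs_re_le_norm _).trans (norm_stableHalfLine_le hβ hβ1 t hz ha.le)

/-- Close the contour to the right: for t ≤ 0 the factor e^{at} is at most 1, while the remaining
bound tends to 0 as a → ∞. -/
theorem stableDensity_of_nonpos {β : ℝ} (hβ : 0 < β) (hβ1 : β < 1) {z t : ℝ} (hz : 0 < z)
    (ht : t ≤ 0) : stableDensity β z t = 0 := by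
  have hc := cos_mul_pi_div_two_pos hβ hβ1
  set c := Real.cos (β * (Real.pi / 2)) with hcdef
  set J := ∫ y in Ioi (0 : ℝ), Real.exp (-(z * c / 2 * y ^ β)) with hJ
  have hJ0 : 0 ≤ J := integral_nonneg fun y => (Real.exp_pos _).le
  have hb : ∀ a : ℝ, 0 < a →
      |stableDensity β z t| ≤ 1 / Real.pi * (1 * Real.exp (-(z * c / 2 * a ^ β)) * J) := by
    intro a ha
    refine (abs_stableDensity_le hβ hβ1 t hz ha).trans ?_
    have : Real.exp (a * t) ≤ 1 := Real.exp_le_one_iff.mpr (by nlinarith)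
    rw [← hcdef, ← hJ]
    gcongr
  have h1 : Tendsto (fun a : ℝ => -(z * c / 2 * a ^ β)) atTop atBot :=
    tendsto_neg_atTop_atBot.comp ((tendsto_rpow_atTop hβ).const_mul_atTop (by positivity))
  have hlim : Tendsto (fun a : ℝ => 1 / Real.pi * (1 * Real.exp (-(z * c / 2 * a ^ β)) * J)) atTop
      (𝓝 0) := by
    have := (((Real.tendsto_exp_atBot.comp h1).const_mul 1).mul_const J).const_mul (1 / Real.pi)
    simpa using this
  have h2 : |stableDensity β z t| ≤ 0 := ge_of_tendsto hlim (by
    filter_upwards [eventually_gt_atTop 0] with a ha using hb a ha)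
  exact abs_nonpos_iff.mp h2

theorem continuous_stableDensity {β : ℝ} (hβ : 0 < β) (hβ1 : β < 1) {z : ℝ} (hz : 0 < z) :
    Continuous (stableDensity β z) := by
  have hc := cos_mul_pi_div_two_pos hβ hβ1
  have h : Continuous fun t => stableHalfLine β z t 0 := by
    refine continuous_of_dominated
      (bound := fun y : ℝ => Real.exp (-(z * Real.cos (β * (Real.pi / 2)) / 2 * y ^ β))) ?_ ?_
      (integrableOn_exp_neg_mul_rpow hβ (by positivity)) ?_
    · exact fun t => Measurable.aestronglyMeasurable (by fun_prop)
    · intro t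
      filter_upwards [ae_restrict_mem measurableSet_Ioi] with y hy
      refine (norm_stableKernel_le hβ hβ1 t hz.le le_rfl (le_of_lt hy)).trans ?_
      simp [Real.zero_rpow hβ.ne']
    · refine Eventually.of_forall fun y => ?_
      unfold stableKernel
      fun_prop
  exact (Complex.continuous_re.comp h).const_mul _ |>.congr fun t => rfl

/-- The function `M_β` decays faster than every exponential. -/
theorem exists_abs_wrightM_le {β : ℝ} (hβ : 0 < β) (hβ1 : β < 1) {l : ℝ} (hl : 0 < l) :
    ∃ C > 0, ∀ z ≥ 0, |wrightM β z| ≤ C * Real.exp (-(l * z)) := by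
  have hc := cos_mul_pi_div_two_pos hβ hβ1
  set c := Real.cos (β * (Real.pi / 2)) with hcdef
  set J := ∫ y in Ioi (0 : ℝ), Real.exp (-(c * y ^ β)) with hJ
  have hJ0 : 0 ≤ J := integral_nonneg fun y => (Real.exp_pos _).le
  -- The abscissa for which the decay factor exp(-(zc/2) a^β) is exactly exp(-lz).
  set a := (2 * l / c) ^ β⁻¹ with ha
  have ha0 : 0 < a := by positivity
  have haβ : a ^ β = 2 * l / c := by
    rw [ha, ← Real.rpow_mul (by positivity), inv_mul_cancel₀ hβ.ne', Real.rpow_one]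
  obtain ⟨B, hB⟩ := (isCompact_Icc (a := (0 : ℝ)) (b := 2)).exists_bound_of_continuousOn
    (continuous_wrightM hβ hβ1).continuousOn
  set C := max 1 (max (B * Real.exp (l * 2)) (1 / (2 * β) * (1 / Real.pi * (Real.exp a * J))))
  have hC0 : 0 < C := lt_of_lt_of_le one_pos (le_max_left _ _)
  refine ⟨C, hC0, fun z hz => ?_⟩
  -- Small z are handled by compactness. For z ≥ 2 one uses ℓ_z(1) = β z M(z): the factor βz stays
  -- away from 0, and zc/2 ≥ c bounds the remaining integral by J.
  by_cases h2 : z ≤ 2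
  · have h := hB z ⟨hz, h2⟩
    rw [Real.norm_eq_abs] at h
    have hB0 : 0 ≤ B := (abs_nonneg _).trans h
    calc |wrightM β z| ≤ B * Real.exp (l * 2) * Real.exp (-(l * 2)) := by
          rw [mul_assoc, ← Real.exp_add]; simpa using h
      _ ≤ C * Real.exp (-(l * z)) := by
          gcongr
          exact (le_max_left _ _).trans (le_max_right _ _)
  · have hz2 : 2 ≤ z := le_of_not_ge h2
    have hz0 : 0 < z := by linarith
    have h := abs_stableDensity_le hβ hβ1 1 hz0 ha0
    rw [stableDensity_eq_wrightAux hβ hβ1 hz0 one_pos, wrightAux_eq hβ hβ1] at h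
    simp only [inv_one, Real.one_rpow, div_one, one_mul, mul_one] at h
    rw [abs_mul, abs_of_pos (mul_pos hβ hz0), ← hcdef, haβ] at h
    have e1 : z * c / 2 * (2 * l / c) = l * z := by field_simp
    rw [e1] at h
    have hJz : ∫ y in Ioi (0 : ℝ), Real.exp (-(z * c / 2 * y ^ β)) ≤ J := by
      refine setIntegral_mono_on (integrableOn_exp_neg_mul_rpow hβ (by positivity))
        (integrableOn_exp_neg_mul_rpow hβ hc) measurableSet_Ioi fun y hy => ?_
      have := Real.rpow_nonneg (le_of_lt hy) β
      refine Real.exp_le_exp.mpr (neg_le_neg ?_)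
      gcongr
      nlinarith
    have h3 : 2 * β * |wrightM β z| ≤ 1 / Real.pi * (Real.exp a * Real.exp (-(l * z)) * J) := by
      calc 2 * β * |wrightM β z| ≤ β * z * |wrightM β z| := by
            gcongr ?_ * _
            nlinarith
        _ ≤ _ := h
        _ ≤ _ := by gcongr
    calc |wrightM β z| = 1 / (2 * β) * (2 * β * |wrightM β z|) := by field_simp
      _ ≤ 1 / (2 * β) * (1 / Real.pi * (Real.exp a * Real.exp (-(l * z)) * J)) := by gcongr
      _ = 1 / (2 * β) * (1 / Real.pi * (Real.exp a * J)) * Real.exp (-(l * z)) := by ring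
      _ ≤ C * Real.exp (-(l * z)) := by
        gcongr
        exact (le_max_right _ _).trans (le_max_right _ _)

/-! ### The Abel integral of the stable density. -/

theorem intervalIntegrable_sub_rpow_neg {β : ℝ} (hβ1 : β < 1) (t a b : ℝ) :
    IntervalIntegrable (fun τ => (t - τ) ^ (-β)) volume a b := by
  simpa using (intervalIntegral.intervalIntegrable_rpow' (r := -β) (by linarith)
    (a := t - a) (b := t - b)).comp_sub_left t

/-- Integrate the derivative of the kernel along Re σ = 1. The boundary value at y = 0 is real, so
it disappears from the imaginary part. The line Re σ = 1 is used because σ^{β-1} is bounded there,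
whereas it is singular at 0. -/
theorem integral_Ioi_cpow_mul_stableKernel {β : ℝ} (hβ : 0 < β) (hβ1 : β < 1) {z t : ℝ}
    (hz : 0 < z) :
    z * β * (∫ y in Ioi (0 : ℝ), stableKernel β z t ((1 : ℝ) + y * Complex.I) *
        ((1 : ℝ) + y * Complex.I) ^ ((β : ℂ) - 1)).re = t * (stableHalfLine β z t 1).re := by
  have hc := cos_mul_pi_div_two_pos hβ hβ1
  set c := Real.cos (β * (Real.pi / 2)) with hcdef
  let K : ℝ → ℂ := fun y => stableKernel β z t ((1 : ℝ) + y * Complex.I)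
  let S : ℝ → ℂ := fun y => ((1 : ℝ) + y * Complex.I : ℂ) ^ ((β : ℂ) - 1)
  have hK : IntegrableOn K (Ioi 0) := integrableOn_stableKernel hβ hβ1 t hz zero_le_one
  have hre : ∀ y : ℝ, ((1 : ℝ) + y * Complex.I : ℂ).re = 1 := fun y => by simp
  have hS : ∀ y : ℝ, ‖S y‖ ≤ 1 := by
    intro y
    have h0 : ((1 : ℝ) + y * Complex.I : ℂ) ≠ 0 := fun h => by
      have := hre y
      rw [h] at this
      simp at this
    have h1 : (1 : ℝ) ≤ ‖((1 : ℝ) + y * Complex.I : ℂ)‖ :=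
      (le_of_eq (hre y).symm).trans (Complex.re_le_norm _)
    have e : ((β : ℂ) - 1) = ((β - 1 : ℝ) : ℂ) := by push_cast; rfl
    simp only [S]
    rw [e, Complex.norm_cpow_real]
    exact Real.rpow_le_one_of_one_le_of_nonpos h1 (by linarith)
  have hSm : Measurable S := by fun_prop
  have hKS : IntegrableOn (fun y => K y * S y) (Ioi 0) :=
    Integrable.mul_bdd (c := 1) hK hSm.aestronglyMeasurable (Eventually.of_forall hS)
  have hd : ∀ y : ℝ, HasDerivAt K ((t * Complex.I) * K y - (z * β * Complex.I) * (K y * S y)) y := by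
    intro y
    have h1 : HasDerivAt (fun y : ℝ => ((1 : ℝ) + y * Complex.I : ℂ)) Complex.I y := by
      simpa using ((Complex.ofRealCLM.hasDerivAt (x := y)).mul_const Complex.I).const_add
        ((1 : ℝ) : ℂ)
    have h2 := (hasDerivAt_stableKernel β z t (σ := (1 : ℝ) + y * Complex.I)
      (by rw [hre]; exact one_pos)).comp y h1
    refine h2.congr_deriv ?_
    simp only [K, S]
    ring
  have hlim : Tendsto K atTop (𝓝 0) := by
    have h1 : Tendsto (fun y : ℝ => -(z * c / 2 * y ^ β)) atTop atBot :=
      tendsto_neg_atTop_atBot.comp ((tendsto_rpow_atTop hβ).const_mul_atTop (by positivity))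
    refine squeeze_zero_norm' (a := fun y => Real.exp (1 * t) * Real.exp (-(z * c / 2 * 1 ^ β)) *
      Real.exp (-(z * c / 2 * y ^ β))) ?_ ?_
    · filter_upwards [eventually_ge_atTop 0] with y hy
      exact norm_stableKernel_le hβ hβ1 t hz.le zero_le_one hy
    · simpa using (Real.tendsto_exp_atBot.comp h1).const_mul
        (Real.exp (1 * t) * Real.exp (-(z * c / 2 * 1 ^ β)))
  have h := integral_Ioi_of_hasDerivAt_of_tendsto (a := 0) (hd 0).continuousAt.continuousWithinAt
    (fun y _ => hd y) ((hK.const_mul _).sub (hKS.const_mul _)) hlim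
  rw [integral_sub (hK.const_mul _) (hKS.const_mul _), integral_const_mul, integral_const_mul] at h
  have him := congrArg Complex.im h
  have h0 : (K 0).im = 0 := by
    have := stableKernel_ofReal_im (β := β) (z := z) (t := t) zero_le_one
    simpa [K] using this
  have e : stableHalfLine β z t 1 = ∫ y in Ioi (0 : ℝ), K y := rfl
  rw [e]
  simp only [Complex.sub_im, Complex.mul_im, Complex.mul_re, Complex.ofReal_re, Complex.ofReal_im,
    Complex.I_re, Complex.I_im, h0, Complex.zero_im] at him
  simp only [K, S] at him ⊢
  linarith

/-- Abel integral of the stable density along the half line. -/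
theorem integral_Ioi_rpow_mul_stableDensity {β : ℝ} (hβ : 0 < β) (hβ1 : β < 1) {z t : ℝ}
    (hz : 0 < z) :
    ∫ x in Ioi (0 : ℝ), x ^ (-β) * stableDensity β z (t - x) =
      Real.Gamma (1 - β) * (t / (β * z) * stableDensity β z t) := by
  have hc := cos_mul_pi_div_two_pos hβ hβ1
  set c := Real.cos (β * (Real.pi / 2)) with hcdef
  -- Fubini in x and y. On Re σ = 1 the kernel at time t - x carries a factor e^{-x}, which gives
  -- absolute convergence; the x-integral then produces Γ(1-β) σ^{β-1}.
  let F : ℝ → ℝ → ℂ := fun x y =>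
    ((x ^ (-β) : ℝ) : ℂ) * stableKernel β z (t - x) ((1 : ℝ) + y * Complex.I)
  have hFm : Measurable (Function.uncurry F) := by
    unfold F stableKernel Function.uncurry
    fun_prop
  have hFint : Integrable (Function.uncurry F)
      ((volume.restrict (Ioi (0 : ℝ))).prod (volume.restrict (Ioi (0 : ℝ)))) := by
    have h1 : IntegrableOn (fun x : ℝ => x ^ (-β) * Real.exp (-(1 * x))) (Ioi 0) :=
      integrableOn_rpow_mul_exp_neg_mul (by linarith) one_pos
    have h2 : IntegrableOn (fun y : ℝ => Real.exp t * Real.exp (-(z * c / 2 * y ^ β))) (Ioi 0) :=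
      (integrableOn_exp_neg_mul_rpow hβ (by positivity)).const_mul _
    refine (h1.mul_prod h2).mono' hFm.aestronglyMeasurable ?_
    rw [Measure.prod_restrict]
    filter_upwards [ae_restrict_mem (measurableSet_Ioi.prod measurableSet_Ioi)] with p hp
    have hx : 0 < p.1 := hp.1
    have hy : 0 < p.2 := hp.2
    have hk := norm_stableKernel_le hβ hβ1 (t - p.1) hz.le zero_le_one hy.le
    simp only [Function.uncurry, F]
    rw [norm_mul, Complex.norm_real, Real.norm_of_nonneg (by positivity), mul_assoc]
    gcongr
    refine hk.trans ?_
    rw [← mul_assoc, ← Real.exp_add (-(1 * p.1)), ← hcdef]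
    gcongr
    rw [← Real.exp_add, Real.one_rpow]
    refine Real.exp_le_exp.mpr ?_
    have : 0 ≤ z * c / 2 := by positivity
    linarith
  have hswap := integral_integral_swap hFint
  have hL : ∀ x : ℝ, ∫ y in Ioi (0 : ℝ), F x y = ((x ^ (-β) : ℝ) : ℂ) * stableHalfLine β z (t - x) 1 :=
    fun x => integral_const_mul _ _
  have hR : ∀ y : ℝ, ∫ x in Ioi (0 : ℝ), F x y = Real.Gamma (1 - β) *
      (stableKernel β z t ((1 : ℝ) + y * Complex.I) * ((1 : ℝ) + y * Complex.I) ^ ((β : ℂ) - 1)) := by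
    intro y
    have h := integral_rpow_mul_cexp_neg_mul_Ioi (s := 1 - β) (r := (1 : ℝ) + y * Complex.I)
      (by linarith) (by simp)
    have e1 : ∀ x : ℝ, F x y = stableKernel β z t ((1 : ℝ) + y * Complex.I) *
        (((x ^ (1 - β - 1) : ℝ) : ℂ) * Complex.exp (-(((1 : ℝ) + y * Complex.I) * x))) := by
      intro x
      simp only [F, stableKernel]
      rw [show 1 - β - 1 = -β by ring, mul_left_comm, ← Complex.exp_add]
      congr 2
      push_cast
      ring
    simp_rw [e1]
    rw [integral_const_mul, h]
    push_cast
    rw [neg_sub]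
    ring
  simp_rw [hL, hR] at hswap
  rw [integral_const_mul] at hswap
  have hre := congrArg Complex.re hswap
  have hI : IntegrableOn (fun x : ℝ => ((x ^ (-β) : ℝ) : ℂ) * stableHalfLine β z (t - x) 1) (Ioi 0) := by
    refine hFint.integral_prod_left.congr (Eventually.of_forall fun x => ?_)
    exact hL x
  have hre1 := integral_re hI
  simp only [RCLike.re_to_complex] at hre1
  rw [← hre1, Complex.re_ofReal_mul] at hre
  have hb := integral_Ioi_cpow_mul_stableKernel hβ hβ1 (t := t) hz
  simp_rw [stableDensity_eq_halfLine hβ hβ1 _ hz one_pos]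
  have e2 : ∀ x : ℝ, x ^ (-β) * (1 / Real.pi * (stableHalfLine β z (t - x) 1).re) =
      1 / Real.pi * ((((x ^ (-β) : ℝ) : ℂ) * stableHalfLine β z (t - x) 1).re) := by
    intro x
    rw [Complex.re_ofReal_mul]
    ring
  simp_rw [e2]
  rw [integral_const_mul, hre]
  generalize (∫ y in Ioi (0 : ℝ), stableKernel β z t ((1 : ℝ) + y * Complex.I) *
        ((1 : ℝ) + y * Complex.I) ^ ((β : ℂ) - 1)).re = X at hb ⊢
  rw [show t / (β * z) * (1 / Real.pi * (stableHalfLine β z t 1).re) =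
    1 / (Real.pi * (β * z)) * (t * (stableHalfLine β z t 1).re) by field_simp, ← hb]
  field_simp

/-- The Abel integral of order `1 - β` of the stable density is the Wright density. -/
theorem integral_sub_rpow_mul_stableDensity {β : ℝ} (hβ : 0 < β) (hβ1 : β < 1) {z t : ℝ}
    (hz : 0 < z) (ht : 0 < t) :
    ∫ τ in (0 : ℝ)..t, (t - τ) ^ (-β) * stableDensity β z τ =
      Real.Gamma (1 - β) * (t / (β * z) * stableDensity β z t) := by
  rw [← integral_Ioi_rpow_mul_stableDensity hβ hβ1 hz]
  have h := intervalIntegral.integral_comp_sub_left (a := 0) (b := t)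
    (fun x => x ^ (-β) * stableDensity β z (t - x)) t
  simp only [sub_sub_cancel, sub_self, sub_zero] at h
  rw [h, intervalIntegral.integral_of_le ht.le]
  -- The range x > t contributes nothing, since the stable density vanishes at negative times.
  refine (setIntegral_eq_of_subset_of_forall_sdiff_eq_zero measurableSet_Ioi
    Ioc_subset_Ioi_self fun x hx => ?_).symm
  have h1 : 0 < x := hx.1
  have h2 : t < x := by
    by_contra h
    exact hx.2 ⟨h1, le_of_not_gt h⟩
  rw [stableDensity_of_nonpos hβ hβ1 hz (by linarith), mul_zero]

/-! ### Positivity of the densities. -/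

/-- Extremum principle for the Caputo derivative: at a maximum over `[0, t]`. -/
theorem rpow_neg_mul_sub_le_integral {β : ℝ} (hβ : 0 < β) (hβ1 : β < 1) {y k : ℝ → ℝ}
    (hk : Continuous k) (hy : ∀ τ, HasDerivAt y (k τ) τ) {t : ℝ} (ht : 0 < t)
    (hmax : ∀ τ ∈ Icc 0 t, y τ ≤ y t) :
    t ^ (-β) * (y t - y 0) ≤ ∫ τ in (0 : ℝ)..t, (t - τ) ^ (-β) * k τ := by
  have hint : ∀ a b, IntervalIntegrable (fun τ => (t - τ) ^ (-β) * k τ) volume a b := fun a b =>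
    (intervalIntegrable_sub_rpow_neg hβ1 t a b).mul_continuousOn hk.continuousOn
  -- Integration by parts as monotonicity: the terms with k cancel in Φ', leaving β(t-τ)^{-β-1}(y t
  -- - y τ) ≥ 0, and the claim is Φ 0 ≤ Φ t. The Lipschitz bound below makes the first summand
  -- continuous at τ = t, where it is 0.
  let Φ : ℝ → ℝ := fun τ => (t - τ) ^ (-β) * (y t - y τ) + ∫ s in (0 : ℝ)..τ, (t - s) ^ (-β) * k s
  have hyc : Continuous y := continuous_iff_continuousAt.mpr fun τ => (hy τ).continuousAt
  obtain ⟨C, hC⟩ := (isCompact_Icc (a := 0) (b := t)).exists_bound_of_continuousOn hk.continuousOn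
  have hlip : ∀ τ ∈ Icc 0 t, |y t - y τ| ≤ C * (t - τ) := by
    intro τ hτ
    have := Convex.norm_image_sub_le_of_norm_hasDerivWithin_le
      (fun x _ => (hy x).hasDerivWithinAt) hC (convex_Icc 0 t) hτ (right_mem_Icc.mpr ht.le)
    rwa [Real.norm_eq_abs, Real.norm_of_nonneg (sub_nonneg.mpr hτ.2)] at this
  have hbase : ∀ τ ∈ Ico 0 t, 0 < t - τ := fun τ hτ => sub_pos.mpr hτ.2
  have hc1 : ContinuousOn (fun τ => (t - τ) ^ (-β) * (y t - y τ)) (Icc 0 t) := by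
    intro τ hτ
    rcases hτ.2.lt_or_eq with h | rfl
    · refine ContinuousAt.continuousWithinAt (ContinuousAt.mul ?_ (by fun_prop))
      exact ContinuousAt.rpow_const (by fun_prop) (Or.inl (sub_pos.mpr h).ne')
    · rw [ContinuousWithinAt, sub_self, sub_self, mul_zero]
      have hb : Tendsto (fun x => C * (τ - x) ^ (1 - β)) (𝓝[Icc 0 τ] τ) (𝓝 0) := by
        have : ContinuousAt (fun x => C * (τ - x) ^ (1 - β)) τ :=
          (ContinuousAt.rpow_const (by fun_prop) (Or.inr (by linarith))).const_mul C
        have h0 : C * (τ - τ) ^ (1 - β) = 0 := by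
          rw [sub_self, Real.zero_rpow (by linarith), mul_zero]
        have h2 := this.tendsto
        rw [h0] at h2
        exact h2.mono_left nhdsWithin_le_nhds
      refine squeeze_zero_norm' ?_ hb
      filter_upwards [self_mem_nhdsWithin] with x hx
      rcases hx.2.lt_or_eq with h | rfl
      · have h0 : 0 < τ - x := sub_pos.mpr h
        rw [norm_mul, Real.norm_of_nonneg (Real.rpow_nonneg h0.le _), Real.norm_eq_abs]
        calc (τ - x) ^ (-β) * |y τ - y x| ≤ (τ - x) ^ (-β) * (C * (τ - x)) := by
              gcongr; exact hlip x hx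
          _ = C * (τ - x) ^ (1 - β) := by
              rw [show 1 - β = -β + 1 by ring, Real.rpow_add_one h0.ne']; ring
      · simp [Real.zero_rpow (show 1 - β ≠ 0 by linarith)]
  have hc2 : ContinuousOn (fun τ => ∫ s in (0 : ℝ)..τ, (t - s) ^ (-β) * k s) (Icc 0 t) :=
    (intervalIntegral.continuous_primitive hint 0).continuousOn
  have hder : ∀ τ ∈ Ioo 0 t, HasDerivAt Φ (β * (t - τ) ^ (-β - 1) * (y t - y τ)) τ := by
    intro τ hτ
    have h0 : 0 < t - τ := sub_pos.mpr hτ.2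
    have h1 : HasDerivAt (fun τ => (t - τ) ^ (-β)) (β * (t - τ) ^ (-β - 1)) τ := by
      have := ((hasDerivAt_id τ).const_sub t).rpow_const (p := -β) (Or.inl h0.ne')
      simpa using this
    have h2 : HasDerivAt (fun τ => ∫ s in (0 : ℝ)..τ, (t - s) ^ (-β) * k s)
        ((t - τ) ^ (-β) * k τ) τ := by
      refine intervalIntegral.integral_hasDerivAt_right (hint 0 τ) ?_ ?_
      · exact Measurable.stronglyMeasurable (by fun_prop) |>.stronglyMeasurableAtFilter
      · exact (ContinuousAt.rpow_const (by fun_prop) (Or.inl h0.ne')).mul hk.continuousAt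
    refine ((h1.mul ((hy τ).const_sub (y t))).add h2).congr_deriv ?_
    ring
  have hmono : MonotoneOn Φ (Icc 0 t) := by
    refine monotoneOn_of_deriv_nonneg (convex_Icc 0 t) (hc1.add hc2) ?_ ?_
    · rw [interior_Icc]
      exact fun τ hτ => (hder τ hτ).differentiableAt.differentiableWithinAt
    · rw [interior_Icc]
      intro τ hτ
      rw [(hder τ hτ).deriv]
      have h0 : 0 < t - τ := sub_pos.mpr hτ.2
      have := sub_nonneg.mpr (hmax τ ⟨hτ.1.le, hτ.2.le⟩)
      positivity
  have := hmono (left_mem_Icc.mpr ht.le) (right_mem_Icc.mpr ht.le) ht.le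
  simpa [Φ] using this

/-- At an interior maximum m the derivative k vanishes, hence so does the Abel integral a m k(m);
but the extremum principle bounds that integral below by m^{-β} y(m) > 0. A positive maximum
therefore sits at the right end point. -/
theorem le_of_exists_pos_of_abel {β : ℝ} (hβ : 0 < β) (hβ1 : β < 1) {y k : ℝ → ℝ}
    (hk : Continuous k) (hy : ∀ τ, HasDerivAt y (k τ) τ) (hy0 : y 0 = 0) {a : ℝ}
    (habel : ∀ t > 0, ∫ τ in (0 : ℝ)..t, (t - τ) ^ (-β) * k τ = a * t * k t) {t : ℝ} (ht : 0 < t)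
    (hpos : ∃ τ ∈ Icc 0 t, 0 < y τ) : ∀ τ ∈ Icc 0 t, y τ ≤ y t := by
  have hyc : Continuous y := continuous_iff_continuousAt.mpr fun τ => (hy τ).continuousAt
  obtain ⟨m, hm, hmax⟩ := (isCompact_Icc (a := 0) (b := t)).exists_isMaxOn
    (nonempty_Icc.mpr ht.le) hyc.continuousOn
  obtain ⟨τ₀, hτ₀, hp⟩ := hpos
  have hym : 0 < y m := hp.trans_le (hmax hτ₀)
  have hm0 : 0 < m := by
    rcases hm.1.lt_or_eq with h | h
    · exact h
    · rw [← h, hy0] at hym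
      exact absurd hym (lt_irrefl _)
  rcases hm.2.lt_or_eq with h | rfl
  · exfalso
    have hloc : IsLocalMax y m := hmax.isLocalMax (Icc_mem_nhds hm0 h)
    have hk0 : k m = 0 := hloc.hasDerivAt_eq_zero (hy m)
    have h1 := rpow_neg_mul_sub_le_integral hβ hβ1 hk hy hm0
      (fun τ hτ => hmax ⟨hτ.1, hτ.2.trans h.le⟩)
    rw [habel m hm0, hk0, mul_zero, hy0, sub_zero] at h1
    have : 0 < m ^ (-β) * y m := by positivity
    linarith
  · exact hmax

theorem Gamma_one_sub_pos {β : ℝ} (hβ1 : β < 1) : 0 < Real.Gamma (1 - β) :=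
  Real.Gamma_pos_of_pos (by linarith)

theorem tendsto_div_rpow_atTop {β : ℝ} (hβ : 0 < β) (c : ℝ) :
    Tendsto (fun t : ℝ => c / t ^ β) atTop (𝓝 0) :=
  (tendsto_rpow_atTop hβ).const_div_atTop c

/-- Let y be the primitive of ℓ_1. As M(0) > 0, ℓ_1 is positive at large times, so y is eventually
strictly increasing. If y were negative somewhere, the principle for -y would put the maximum of -y
over [0, a+1] at a + 1, contradicting this. So y ≥ 0, and the principle applied to y itself makes it
increasing. -/
theorem stableDensity_one_nonneg {β : ℝ} (hβ : 0 < β) (hβ1 : β < 1) (t : ℝ) :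
    0 ≤ stableDensity β 1 t := by
  set k := stableDensity β 1 with hkdef
  have hk : Continuous k := continuous_stableDensity hβ hβ1 one_pos
  let y : ℝ → ℝ := fun t => ∫ s in (0 : ℝ)..t, k s
  have hy : ∀ τ, HasDerivAt y (k τ) τ := fun τ => hk.integral_hasStrictDerivAt 0 τ |>.hasDerivAt
  have hyc : Continuous y := continuous_iff_continuousAt.mpr fun τ => (hy τ).continuousAt
  have hy0 : y 0 = 0 := by simp [y]
  have habel : ∀ t > 0, ∫ τ in (0 : ℝ)..t, (t - τ) ^ (-β) * k τ =
      Real.Gamma (1 - β) / β * t * k t := by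
    intro t ht
    rw [hkdef, integral_sub_rpow_mul_stableDensity hβ hβ1 one_pos ht]
    field_simp
  have hev : ∀ᶠ t in atTop, 0 < k t := by
    have h0 : Tendsto (fun t : ℝ => wrightM β (1 / t ^ β)) atTop (𝓝 (wrightM β 0)) :=
      ((continuous_wrightM hβ hβ1).tendsto 0).comp (tendsto_div_rpow_atTop hβ 1)
    have hM0 : 0 < wrightM β 0 := by
      rw [wrightM_zero]
      have := Gamma_one_sub_pos hβ1
      positivity
    filter_upwards [h0.eventually_const_lt hM0, eventually_gt_atTop 0] with t h1 h2
    rw [hkdef, stableDensity_eq_wrightDensity hβ hβ1 one_pos h2, wrightDensity_eq]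
    positivity
  obtain ⟨T, hT⟩ := eventually_atTop.mp hev
  have hinc : ∀ a b, T ≤ a → a < b → y a < y b := by
    intro a b ha hab
    have : StrictMonoOn y (Ici T) := strictMonoOn_of_deriv_pos (convex_Ici T) hyc.continuousOn
      fun x hx => by
        rw [(hy x).deriv]
        exact hT x (interior_subset hx)
    exact this ha (ha.trans hab.le) hab
  have hnn : ∀ t, 0 ≤ t → 0 ≤ y t := by
    intro t ht
    by_contra hlt
    push Not at hlt
    set a := max (max t T) 1
    have ha : t ≤ a := (le_max_left t T).trans (le_max_left _ _)
    have haT : T ≤ a := (le_max_right t T).trans (le_max_left _ _)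
    have h := le_of_exists_pos_of_abel hβ hβ1 (y := fun t => -y t) (k := fun t => -k t) hk.neg
      (fun τ => (hy τ).fun_neg) (by simp [hy0]) (a := Real.Gamma (1 - β) / β)
      (fun t ht => by
        simp only [mul_neg, intervalIntegral.integral_neg]
        rw [habel t ht])
      (t := a + 1) (by linarith) ⟨t, ⟨ht, by linarith⟩, by simpa using hlt⟩ a ⟨by linarith, by linarith⟩
    have := hinc a (a + 1) haT (by linarith)
    linarith
  have hmono : MonotoneOn y (Ici 0) := by
    intro a ha b hb hab
    rcases (hnn a ha).lt_or_eq with h | h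
    · rcases hab.lt_or_eq with h' | rfl
      · have ha' : 0 ≤ a := ha
        exact le_of_exists_pos_of_abel hβ hβ1 hk hy hy0 habel (lt_of_le_of_lt ha' h')
          ⟨a, ⟨ha, hab⟩, h⟩ a ⟨ha, hab⟩
      · exact le_rfl
    · rw [← h]
      exact hnn b hb
  rcases le_or_gt t 0 with ht | ht
  · rw [hkdef, stableDensity_of_nonpos hβ hβ1 one_pos ht]
  · have h1 := hmono.derivWithin_nonneg (x := t)
    have h2 : derivWithin y (Ici 0) t = k t :=
      (hy t).hasDerivWithinAt.derivWithin (uniqueDiffOn_Ici 0 t ht.le)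
    rwa [h2] at h1

theorem wrightM_nonneg {β : ℝ} (hβ : 0 < β) (hβ1 : β < 1) {z : ℝ} (hz : 0 ≤ z) :
    0 ≤ wrightM β z := by
  rcases hz.lt_or_eq with h | rfl
  · have ht : 0 < z ^ (-β⁻¹) := by positivity
    have hk := stableDensity_one_nonneg hβ hβ1 (z ^ (-β⁻¹))
    have e : 1 / (z ^ (-β⁻¹)) ^ β = z := by
      rw [← Real.rpow_mul hz, neg_mul, inv_mul_cancel₀ hβ.ne', Real.rpow_neg_one, one_div, inv_inv]
    rw [stableDensity_eq_wrightAux hβ hβ1 one_pos ht, e, wrightAux_eq hβ hβ1] at hk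
    have h1 : 0 < (z ^ (-β⁻¹))⁻¹ * (β * z) := by positivity
    rw [← mul_assoc] at hk
    exact nonneg_of_mul_nonneg_right hk h1
  · rw [wrightM_zero]
    have := Gamma_one_sub_pos hβ1
    positivity

/-! ### The tail of M and its total mass. -/

theorem integrableOn_exp_neg_mul_Ioi {l : ℝ} (hl : 0 < l) (a : ℝ) :
    IntegrableOn (fun z => Real.exp (-(l * z))) (Ioi a) := by
  simpa using integrableOn_exp_mul_Ioi (neg_lt_zero.mpr hl) a

theorem integrableOn_wrightM {β : ℝ} (hβ : 0 < β) (hβ1 : β < 1) {a : ℝ} (ha : 0 ≤ a) :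
    IntegrableOn (wrightM β) (Ioi a) := by
  obtain ⟨C, -, hC⟩ := exists_abs_wrightM_le hβ hβ1 one_pos
  refine ((integrableOn_exp_neg_mul_Ioi one_pos a).const_mul C).mono'
    (continuous_wrightM hβ hβ1).aestronglyMeasurable ?_
  filter_upwards [ae_restrict_mem measurableSet_Ioi] with z hz
  exact hC z (ha.trans (le_of_lt hz))

/-- The tail `∫_z^∞ M_β`. -/
def wrightTail (β z : ℝ) : ℝ := ∫ w in Ioi z, wrightM β w

theorem wrightTail_nonneg {β : ℝ} (hβ : 0 < β) (hβ1 : β < 1) {z : ℝ} (hz : 0 ≤ z) :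
    0 ≤ wrightTail β z :=
  setIntegral_nonneg measurableSet_Ioi fun _ hw => wrightM_nonneg hβ hβ1 (hz.trans (le_of_lt hw))

theorem exists_wrightTail_le {β : ℝ} (hβ : 0 < β) (hβ1 : β < 1) {l : ℝ} (hl : 0 < l) :
    ∃ C > 0, ∀ z ≥ 0, wrightTail β z ≤ C * Real.exp (-(l * z)) := by
  obtain ⟨C, hC0, hC⟩ := exists_abs_wrightM_le hβ hβ1 hl
  refine ⟨C / l, by positivity, fun z hz => ?_⟩
  calc wrightTail β z ≤ ∫ w in Ioi z, C * Real.exp (-(l * w)) := by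
        refine setIntegral_mono_on (integrableOn_wrightM hβ hβ1 hz)
          ((integrableOn_exp_neg_mul_Ioi hl z).const_mul C) measurableSet_Ioi fun w hw => ?_
        exact (le_abs_self _).trans (hC w (hz.trans (le_of_lt hw)))
    _ = C / l * Real.exp (-(l * z)) := by
        rw [integral_const_mul]
        have := integral_exp_mul_Ioi (neg_lt_zero.mpr hl) z
        simp only [neg_mul] at this
        rw [this]
        field_simp

theorem wrightTail_antitoneOn {β : ℝ} (hβ : 0 < β) (hβ1 : β < 1) :
    AntitoneOn (wrightTail β) (Ici 0) := by
  intro a ha b hb hab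
  refine setIntegral_mono_set (integrableOn_wrightM hβ hβ1 ha) ?_
    (LE.le.eventuallyLE (Ioi_subset_Ioi hab))
  filter_upwards [ae_restrict_mem measurableSet_Ioi] with w hw
  exact wrightM_nonneg hβ hβ1 (le_trans ha (le_of_lt hw))

theorem wrightTail_eq_sub {β : ℝ} (hβ : 0 < β) (hβ1 : β < 1) {z : ℝ} (hz : 0 ≤ z) :
    wrightTail β z = wrightTail β 0 - ∫ w in (0 : ℝ)..z, wrightM β w := by
  have h := intervalIntegral.integral_Ioi_sub_Ioi (f := wrightM β) (μ := volume)
    (integrableOn_wrightM hβ hβ1 le_rfl) hz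
  unfold wrightTail
  linarith

theorem hasDerivAt_wrightTail {β : ℝ} (hβ : 0 < β) (hβ1 : β < 1) {z : ℝ} (hz : 0 < z) :
    HasDerivAt (wrightTail β) (-wrightM β z) z := by
  have h := ((continuous_wrightM hβ hβ1).integral_hasStrictDerivAt 0 z).hasDerivAt.const_sub
    (wrightTail β 0)
  refine h.congr_of_eventuallyEq ?_
  filter_upwards [lt_mem_nhds hz] with w hw
  exact wrightTail_eq_sub hβ hβ1 hw.le

theorem continuousOn_wrightTail {β : ℝ} (hβ : 0 < β) (hβ1 : β < 1) :
    ContinuousOn (wrightTail β) (Ici 0) := by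
  have h : Continuous fun z => wrightTail β 0 - ∫ w in (0 : ℝ)..z, wrightM β w :=
    continuous_const.sub (intervalIntegral.continuous_primitive
      (fun a b => (continuous_wrightM hβ hβ1).intervalIntegrable a b) 0)
  exact h.continuousOn.congr fun z hz => wrightTail_eq_sub hβ hβ1 hz

theorem wrightTail_tendsto_zero {β : ℝ} (hβ : 0 < β) (hβ1 : β < 1) :
    Tendsto (wrightTail β) atTop (𝓝 0) := by
  obtain ⟨C, hC0, hC⟩ := exists_wrightTail_le hβ hβ1 one_pos
  have hlim : Tendsto (fun z : ℝ => C * Real.exp (-(1 * z))) atTop (𝓝 0) := by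
    have : Tendsto (fun z : ℝ => -(1 * z)) atTop atBot := by
      simpa using tendsto_neg_atTop_atBot
    simpa using (Real.tendsto_exp_atBot.comp this).const_mul C
  refine tendsto_of_tendsto_of_tendsto_of_le_of_le' tendsto_const_nhds hlim ?_ ?_
  · filter_upwards [eventually_ge_atTop 0] with z hz using wrightTail_nonneg hβ hβ1 hz
  · filter_upwards [eventually_ge_atTop 0] with z hz using hC z hz

/-- This is where the stable density enters the time derivative of the Wright transform: the chain
rule turns the tail of g_β(·;t) beyond s into ℓ_s(t). -/
theorem hasDerivAt_wrightTail_div_rpow {β : ℝ} (hβ : 0 < β) (hβ1 : β < 1) {s t : ℝ} (hs : 0 < s)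
    (ht : 0 < t) :
    HasDerivAt (fun τ => wrightTail β (s / τ ^ β)) (β * s / t * wrightDensity β s t) t := by
  have h1 : HasDerivAt (fun τ : ℝ => s / τ ^ β) (s * (-β * t ^ (-β - 1))) t := by
    have := (Real.hasDerivAt_rpow_const (p := -β) (Or.inl ht.ne')).const_mul s
    refine this.congr_of_eventuallyEq ?_
    filter_upwards [lt_mem_nhds ht] with τ hτ
    rw [Real.rpow_neg hτ.le, div_eq_mul_inv]
  have h2 := (hasDerivAt_wrightTail hβ hβ1 (z := s / t ^ β) (by positivity)).comp t h1
  refine h2.congr_deriv ?_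
  rw [wrightDensity_eq, Real.rpow_sub_one ht.ne', Real.rpow_neg ht.le]
  field_simp

theorem tendsto_div_rpow_nhdsGT_zero {β : ℝ} (hβ : 0 < β) {s : ℝ} (hs : 0 < s) :
    Tendsto (fun t : ℝ => s / t ^ β) (𝓝[>] 0) atTop := by
  have h : Tendsto (fun t : ℝ => t ^ β) (𝓝[>] 0) (𝓝[>] 0) := by
    refine tendsto_nhdsWithin_iff.mpr ⟨?_, ?_⟩
    · have h1 : ContinuousAt (fun t : ℝ => t ^ β) 0 :=
        Real.continuousAt_rpow_const _ _ (Or.inr hβ.le)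
      have h2 := h1.tendsto
      rw [Real.zero_rpow hβ.ne'] at h2
      exact h2.mono_left nhdsWithin_le_nhds
    · filter_upwards [self_mem_nhdsWithin] with t ht
      exact Real.rpow_pos_of_pos ht β
  simp_rw [div_eq_mul_inv]
  exact (tendsto_inv_nhdsGT_zero.comp h).const_mul_atTop hs

theorem integral_stableDensity_eq_wrightTail {β : ℝ} (hβ : 0 < β) (hβ1 : β < 1) {t : ℝ}
    (ht : 0 < t) : ∫ τ in (0 : ℝ)..t, stableDensity β 1 τ = wrightTail β (1 / t ^ β) := by
  have hk := continuous_stableDensity hβ hβ1 one_pos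
  have h := intervalIntegral.integral_eq_sub_of_hasDerivAt_of_tendsto
    (f := fun τ => wrightTail β (1 / τ ^ β)) (f' := stableDensity β 1) (fa := 0)
    (fb := wrightTail β (1 / t ^ β)) ht
    (fun τ hτ => by
      have := hasDerivAt_wrightTail_div_rpow hβ hβ1 one_pos hτ.1
      rwa [← stableDensity_eq_wrightDensity hβ hβ1 one_pos hτ.1] at this)
    (hk.intervalIntegrable 0 t)
    ((wrightTail_tendsto_zero hβ hβ1).comp (tendsto_div_rpow_nhdsGT_zero hβ one_pos))
    ((hasDerivAt_wrightTail_div_rpow hβ hβ1 one_pos ht).continuousAt.tendsto.mono_left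
      nhdsWithin_le_nhds)
  rw [h, sub_zero]

theorem integral_sub_rpow_neg_le {β : ℝ} (hβ1 : β < 1) {a t : ℝ} (ha : 0 ≤ a) (hat : a ≤ t) :
    ∫ τ in a..t, (t - τ) ^ (-β) ≤ t ^ (1 - β) / (1 - β) := by
  have h := intervalIntegral.integral_comp_sub_left (a := a) (b := t) (fun x : ℝ => x ^ (-β)) t
  simp only [sub_self] at h
  rw [h, integral_rpow (Or.inl (by linarith)), show -β + 1 = 1 - β by ring,
    Real.zero_rpow (by linarith), sub_zero]
  have : 0 < 1 - β := by linarith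
  gcongr
  linarith

/-- The Abel identity at `z = 1`, multiplied by `t ^ β`. -/
theorem rpow_mul_integral_eq_wrightM {β : ℝ} (hβ : 0 < β) (hβ1 : β < 1) {t : ℝ} (ht : 0 < t) :
    t ^ β * ∫ τ in (0 : ℝ)..t, (t - τ) ^ (-β) * stableDensity β 1 τ =
      Real.Gamma (1 - β) * wrightM β (1 / t ^ β) := by
  rw [integral_sub_rpow_mul_stableDensity hβ hβ1 one_pos ht,
    stableDensity_eq_wrightDensity hβ hβ1 one_pos ht, wrightDensity_eq]
  field_simp

theorem tendsto_Gamma_mul_wrightM {β : ℝ} (hβ : 0 < β) (hβ1 : β < 1) :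
    Tendsto (fun t : ℝ => Real.Gamma (1 - β) * wrightM β (1 / t ^ β)) atTop (𝓝 1) := by
  have h := (((continuous_wrightM hβ hβ1).tendsto 0).comp
    (tendsto_div_rpow_atTop hβ 1)).const_mul (Real.Gamma (1 - β))
  rw [wrightM_zero, mul_one_div_cancel (Gamma_one_sub_pos hβ1).ne'] at h
  exact h

theorem tendsto_wrightTail_one_div {β : ℝ} (hβ : 0 < β) (hβ1 : β < 1) :
    Tendsto (fun t : ℝ => wrightTail β (1 / t ^ β)) atTop (𝓝 (wrightTail β 0)) := by
  have h1 : Tendsto (fun t : ℝ => 1 / t ^ β) atTop (𝓝[≥] 0) := by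
    refine tendsto_nhdsWithin_iff.mpr ⟨tendsto_div_rpow_atTop hβ 1, ?_⟩
    filter_upwards [eventually_gt_atTop 0] with t ht
    have : 0 ≤ 1 / t ^ β := by positivity
    exact this
  exact (continuousOn_wrightTail hβ hβ1 0 self_mem_Ici).tendsto.comp h1

theorem intervalIntegrable_abel_stableDensity {β : ℝ} (hβ : 0 < β) (hβ1 : β < 1) {z : ℝ}
    (hz : 0 < z) (t a b : ℝ) :
    IntervalIntegrable (fun τ => (t - τ) ^ (-β) * stableDensity β z τ) volume a b :=
  (intervalIntegrable_sub_rpow_neg hβ1 t a b).mul_continuousOn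
    (continuous_stableDensity hβ hβ1 hz).continuousOn

/-- Since (t-τ)^{-β} ≥ t^{-β}, the primitive of ℓ_1 is at most t^β times its Abel integral, which
tends to Γ(1-β) M(0) = 1 as t → ∞. -/
theorem wrightTail_zero_le_one {β : ℝ} (hβ : 0 < β) (hβ1 : β < 1) : wrightTail β 0 ≤ 1 := by
  refine le_of_tendsto_of_tendsto (tendsto_wrightTail_one_div hβ hβ1)
    (tendsto_Gamma_mul_wrightM hβ hβ1) ?_
  filter_upwards [eventually_gt_atTop 0] with t ht
  rw [← rpow_mul_integral_eq_wrightM hβ hβ1 ht, ← integral_stableDensity_eq_wrightTail hβ hβ1 ht,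
    ← intervalIntegral.integral_const_mul]
  refine intervalIntegral.integral_mono_on_of_le_Ioo ht.le
    ((continuous_stableDensity hβ hβ1 one_pos).intervalIntegrable 0 t)
    ((intervalIntegrable_abel_stableDensity hβ hβ1 one_pos t 0 t).const_mul _) fun τ hτ => ?_
  have hk := stableDensity_one_nonneg hβ hβ1 τ
  have h0 : 0 < t - τ := sub_pos.mpr hτ.2
  have h1 : (t - τ) ^ β ≤ t ^ β := by
    have := hτ.1
    gcongr
    linarith
  rw [← mul_assoc, Real.rpow_neg h0.le, ← div_eq_mul_inv]
  have h2 : 1 ≤ t ^ β / (t - τ) ^ β := (one_le_div (by positivity)).mpr h1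
  exact le_mul_of_one_le_left hk h2

/-- Split the Abel integral at δt. Below δt the kernel is at most ((1-δ)t)^{-β}; above it ℓ_1(τ) =
O(τ^{-1-β}), and this part is O(t^{-β}) even after multiplication by t^β. Let t → ∞, then δ → 0. -/
theorem one_le_wrightTail_zero {β : ℝ} (hβ : 0 < β) (hβ1 : β < 1) : 1 ≤ wrightTail β 0 := by
  obtain ⟨C, hC0, hC⟩ := exists_abs_wrightM_le hβ hβ1 one_pos
  have hβ' : 0 < 1 - β := by linarith
  have key : ∀ δ ∈ Ioo (0 : ℝ) 1, 1 ≤ (1 - δ) ^ (-β) * wrightTail β 0 := by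
    intro δ hδ
    have hδ1 : 0 < 1 - δ := sub_pos.mpr hδ.2
    have hlim : Tendsto (fun t : ℝ => (1 - δ) ^ (-β) * wrightTail β 0 +
        β * C * δ ^ (-1 - β) / (1 - β) / t ^ β) atTop (𝓝 ((1 - δ) ^ (-β) * wrightTail β 0 + 0)) :=
      tendsto_const_nhds.add (tendsto_div_rpow_atTop hβ _)
    rw [add_zero] at hlim
    refine le_of_tendsto_of_tendsto (tendsto_Gamma_mul_wrightM hβ hβ1) hlim ?_
    filter_upwards [eventually_gt_atTop 0] with t ht
    have hδt : 0 < δ * t := mul_pos hδ.1 ht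
    have hδt' : δ * t < t := by nlinarith [hδ.2]
    rw [← rpow_mul_integral_eq_wrightM hβ hβ1 ht, ← intervalIntegral.integral_add_adjacent_intervals
      (intervalIntegrable_abel_stableDensity hβ hβ1 one_pos t 0 (δ * t))
      (intervalIntegrable_abel_stableDensity hβ hβ1 one_pos t (δ * t) t), mul_add]
    have hI1 : ∫ τ in (0 : ℝ)..(δ * t), (t - τ) ^ (-β) * stableDensity β 1 τ ≤
        ((1 - δ) * t) ^ (-β) * wrightTail β 0 := by
      calc _ ≤ ∫ τ in (0 : ℝ)..(δ * t), ((1 - δ) * t) ^ (-β) * stableDensity β 1 τ := by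
            refine intervalIntegral.integral_mono_on_of_le_Ioo hδt.le
              (intervalIntegrable_abel_stableDensity hβ hβ1 one_pos t 0 (δ * t))
              (((continuous_stableDensity hβ hβ1 one_pos).intervalIntegrable 0 _).const_mul _)
              fun τ hτ => ?_
            refine mul_le_mul_of_nonneg_right ?_ (stableDensity_one_nonneg hβ hβ1 τ)
            refine Real.rpow_le_rpow_of_nonpos (by positivity) ?_ (by linarith)
            linarith [hτ.2]
        _ = ((1 - δ) * t) ^ (-β) * wrightTail β (1 / (δ * t) ^ β) := by
            rw [intervalIntegral.integral_const_mul, integral_stableDensity_eq_wrightTail hβ hβ1 hδt]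
        _ ≤ _ := by
            gcongr
            have : 0 ≤ 1 / (δ * t) ^ β := by positivity
            exact wrightTail_antitoneOn hβ hβ1 self_mem_Ici this this
    have hI2 : ∫ τ in (δ * t)..t, (t - τ) ^ (-β) * stableDensity β 1 τ ≤
        t ^ (1 - β) / (1 - β) * (β * C * (δ * t) ^ (-1 - β)) := by
      calc _ ≤ ∫ τ in (δ * t)..t, (t - τ) ^ (-β) * (β * C * (δ * t) ^ (-1 - β)) := by
            refine intervalIntegral.integral_mono_on_of_le_Ioo hδt'.le
              (intervalIntegrable_abel_stableDensity hβ hβ1 one_pos t _ _)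
              ((intervalIntegrable_sub_rpow_neg hβ1 t _ _).mul_const _)
              fun τ hτ => ?_
            have h0 : 0 < t - τ := sub_pos.mpr hτ.2
            have hτ0 : 0 < τ := hδt.trans hτ.1
            refine mul_le_mul_of_nonneg_left ?_ (by positivity)
            rw [stableDensity_eq_wrightDensity hβ hβ1 one_pos hτ0, wrightDensity_eq]
            have hM : wrightM β (1 / τ ^ β) ≤ C := by
              refine (le_abs_self _).trans ((hC _ (by positivity)).trans ?_)
              refine mul_le_of_le_one_right hC0.le (Real.exp_le_one_iff.mpr ?_)
              have : 0 ≤ 1 / τ ^ β := by positivity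
              linarith
            calc β * 1 / τ * (1 / τ ^ β * wrightM β (1 / τ ^ β)) ≤ β * 1 / τ * (1 / τ ^ β * C) := by
                  gcongr
              _ = β * C * τ ^ (-1 - β) := by
                  rw [Real.rpow_sub hτ0, Real.rpow_neg_one]
                  field_simp
              _ ≤ _ := by
                  have : τ ^ (-1 - β) ≤ (δ * t) ^ (-1 - β) :=
                    Real.rpow_le_rpow_of_nonpos hδt hτ.1.le (by linarith)
                  gcongr
        _ = (∫ τ in (δ * t)..t, (t - τ) ^ (-β)) * (β * C * (δ * t) ^ (-1 - β)) :=
            intervalIntegral.integral_mul_const _ _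
        _ ≤ _ := by
            gcongr
            exact integral_sub_rpow_neg_le hβ1 hδt.le hδt'.le
    calc _ ≤ t ^ β * (((1 - δ) * t) ^ (-β) * wrightTail β 0) +
          t ^ β * (t ^ (1 - β) / (1 - β) * (β * C * (δ * t) ^ (-1 - β))) := by gcongr
      _ = _ := by
        rw [Real.mul_rpow hδ1.le ht.le, Real.mul_rpow hδ.1.le ht.le, Real.rpow_sub ht,
          Real.rpow_sub ht, Real.rpow_neg ht.le, Real.rpow_neg_one, Real.rpow_one]
        field_simp
  have hlim : Tendsto (fun δ : ℝ => (1 - δ) ^ (-β) * wrightTail β 0) (𝓝[>] 0)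
      (𝓝 (wrightTail β 0)) := by
    have h1 : ContinuousAt (fun δ : ℝ => (1 - δ) ^ (-β) * wrightTail β 0) 0 := by
      refine ContinuousAt.mul_const (ContinuousAt.rpow_const (by fun_prop) (Or.inl (by simp))) _
    have h2 := h1.tendsto
    simp only [sub_zero, Real.one_rpow, one_mul] at h2
    exact h2.mono_left nhdsWithin_le_nhds
  refine ge_of_tendsto hlim ?_
  filter_upwards [Ioo_mem_nhdsGT one_pos] with δ hδ using key δ hδ

theorem wrightTail_zero {β : ℝ} (hβ : 0 < β) (hβ1 : β < 1) : wrightTail β 0 = 1 :=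
  le_antisymm (wrightTail_zero_le_one hβ hβ1) (one_le_wrightTail_zero hβ hβ1)

/-! ### Exponential bounds in s and functions with Laplace dominated derivative. -/

theorem integrableOn_mul_of_abs_le_exp {h H w : ℝ → ℝ} {c K : ℝ}
    (hH : IntegrableOn (fun s => Real.exp (-(c * s)) * H s) (Ioi 0))
    (hhm : AEStronglyMeasurable h (volume.restrict (Ioi 0))) (hh : ∀ s > 0, |h s| ≤ H s)
    (hwm : AEStronglyMeasurable w (volume.restrict (Ioi 0)))
    (hw : ∀ s > 0, |w s| ≤ K * Real.exp (-(c * s))) :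
    IntegrableOn (fun s => h s * w s) (Ioi 0) := by
  refine (hH.const_mul K).mono' (hhm.mul hwm) ?_
  filter_upwards [ae_restrict_mem measurableSet_Ioi] with s hs
  rw [norm_mul, Real.norm_eq_abs, Real.norm_eq_abs]
  calc |h s| * |w s| ≤ H s * (K * Real.exp (-(c * s))) :=
        mul_le_mul (hh s hs) (hw s hs) (abs_nonneg _) ((abs_nonneg _).trans (hh s hs))
    _ = _ := by ring

@[fun_prop]
theorem measurable_wrightM {β : ℝ} (hβ : 0 < β) (hβ1 : β < 1) : Measurable (wrightM β) :=
  (continuous_wrightM hβ hβ1).measurable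

theorem measurable_wrightDensity {β : ℝ} (hβ : 0 < β) (hβ1 : β < 1) (t : ℝ) :
    Measurable fun s => wrightDensity β s t := by
  have := measurable_wrightM hβ hβ1
  simp_rw [wrightDensity_eq]
  fun_prop

theorem wrightDensity_nonneg {β : ℝ} (hβ : 0 < β) (hβ1 : β < 1) {s t : ℝ} (hs : 0 ≤ s)
    (ht : 0 < t) : 0 ≤ wrightDensity β s t := by
  rw [wrightDensity_eq]
  have := wrightM_nonneg hβ hβ1 (z := s / t ^ β) (by positivity)
  positivity

theorem exists_abs_wrightDensity_le {β : ℝ} (hβ : 0 < β) (hβ1 : β < 1) (c : ℝ) {t : ℝ}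
    (ht : 0 < t) :
    ∃ K > 0, ∀ s > 0, |wrightDensity β s t| ≤ K * Real.exp (-(c * s)) := by
  have htβ : 0 < t ^ β := by positivity
  -- After rescaling by t^β this rate becomes |c| + 1 in the variable s.
  have hl : 0 < (|c| + 1) * t ^ β := by positivity
  obtain ⟨C, hC0, hC⟩ := exists_abs_wrightM_le hβ hβ1 hl
  refine ⟨1 / t ^ β * C, by positivity, fun s hs => ?_⟩
  rw [wrightDensity_eq, abs_mul, abs_of_pos (by positivity : 0 < 1 / t ^ β), mul_assoc]
  gcongr
  refine (hC _ (by positivity)).trans ?_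
  refine mul_le_mul_of_nonneg_left (Real.exp_le_exp.mpr (neg_le_neg ?_)) hC0.le
  rw [mul_assoc, mul_div_cancel₀ _ htβ.ne']
  nlinarith [le_abs_self c]

theorem exists_wrightTail_div_le {β : ℝ} (hβ : 0 < β) (hβ1 : β < 1) (c : ℝ) {t : ℝ}
    (ht : 0 < t) :
    ∃ K > 0, ∀ s > 0, |wrightTail β (s / t ^ β)| ≤ K * Real.exp (-(c * s)) := by
  have htβ : 0 < t ^ β := by positivity
  have hl : 0 < (|c| + 1) * t ^ β := by positivity
  obtain ⟨C, hC0, hC⟩ := exists_wrightTail_le hβ hβ1 hl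
  refine ⟨C, hC0, fun s hs => ?_⟩
  rw [abs_of_nonneg (wrightTail_nonneg hβ hβ1 (by positivity))]
  refine (hC _ (by positivity)).trans ?_
  refine mul_le_mul_of_nonneg_left (Real.exp_le_exp.mpr (neg_le_neg ?_)) hC0.le
  rw [mul_assoc, mul_div_cancel₀ _ htβ.ne']
  nlinarith [le_abs_self c]

/-- Locally uniform bound for the stable density `β s / τ * g_β(s;τ)`. -/
theorem exists_stable_le {β : ℝ} (hβ : 0 < β) (hβ1 : β < 1) (c : ℝ) {t : ℝ} (ht : 0 < t) :
    ∃ K > 0, ∀ τ ∈ Ioo (t / 2) (2 * t), ∀ s > 0,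
      |β * s / τ * wrightDensity β s τ| ≤ K * Real.exp (-(c * s)) := by
  have h2t : 0 < (2 * t) ^ β := by positivity
  -- The rate is taken at τ = 2t, where s/τ^β is smallest on the interval, which makes the bound
  -- uniform in τ.
  have hl : 0 < (|c| + 1) * (2 * t) ^ β := by positivity
  obtain ⟨C, hC0, hC⟩ := exists_abs_wrightM_le hβ hβ1 hl
  refine ⟨β / (t / 2) * (1 / (t / 2) ^ β * C), by positivity, fun τ hτ s hs => ?_⟩
  have hτ0 : 0 < τ := (half_pos ht).trans hτ.1
  have hτβ : 0 < τ ^ β := by positivity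
  have hle : τ ^ β ≤ (2 * t) ^ β := by
    have := hτ.2.le
    gcongr
  rw [wrightDensity_eq, abs_mul, abs_mul, abs_of_pos (by positivity : 0 < β * s / τ),
    abs_of_pos (by positivity : 0 < 1 / τ ^ β)]
  have h1 : |wrightM β (s / τ ^ β)| ≤ C * Real.exp (-((|c| + 1) * s)) := by
    refine (hC _ (by positivity)).trans ?_
    refine mul_le_mul_of_nonneg_left (Real.exp_le_exp.mpr (neg_le_neg ?_)) hC0.le
    have : s / (2 * t) ^ β ≤ s / τ ^ β := by gcongr
    calc (|c| + 1) * s = (|c| + 1) * (2 * t) ^ β * (s / (2 * t) ^ β) := by field_simp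
      _ ≤ _ := by gcongr
  -- The extra 1 in |c| + 1 pays for the factor s.
  have h2 : s * Real.exp (-((|c| + 1) * s)) ≤ Real.exp (-(c * s)) := by
    have h3 : s ≤ Real.exp s := by linarith [Real.add_one_le_exp s]
    calc s * Real.exp (-((|c| + 1) * s)) ≤ Real.exp s * Real.exp (-((|c| + 1) * s)) := by gcongr
      _ = Real.exp (-(|c| * s)) := by rw [← Real.exp_add]; ring_nf
      _ ≤ _ := by
        gcongr
        exact le_abs_self c
  have h4 : (t / 2) ^ β ≤ τ ^ β := by
    have := hτ.1.le
    gcongr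
  calc β * s / τ * (1 / τ ^ β * |wrightM β (s / τ ^ β)|)
      ≤ β * s / (t / 2) * (1 / (t / 2) ^ β * (C * Real.exp (-((|c| + 1) * s)))) := by
        have := hτ.1.le
        gcongr
    _ = β / (t / 2) * (1 / (t / 2) ^ β * C) * (s * Real.exp (-((|c| + 1) * s))) := by ring
    _ ≤ _ := by gcongr

/-- `f` is continuous on `[0,∞)`, differentiable on `(0,∞)`, and its derivative is dominated by a
function with an absolutely convergent Laplace integral. -/
structure HasLaplaceDominatedDeriv (f H : ℝ → ℝ) (c : ℝ) : Prop where
  continuousOn : ContinuousOn f (Ici 0)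
  differentiableAt : ∀ s > 0, DifferentiableAt ℝ f s
  nonneg : 0 ≤ c
  integrableOn : IntegrableOn (fun s => Real.exp (-(c * s)) * H s) (Ioi 0)
  abs_deriv_le : ∀ s > 0, |deriv f s| ≤ H s

namespace HasLaplaceDominatedDeriv

variable {f H : ℝ → ℝ} {c : ℝ}

theorem intervalIntegrable_deriv (hf : HasLaplaceDominatedDeriv f H c) {r : ℝ} (hr : 0 ≤ r) :
    IntervalIntegrable (deriv f) volume 0 r := by
  rw [intervalIntegrable_iff_integrableOn_Ioc_of_le hr]
  refine ((hf.integrableOn.mono_set Ioc_subset_Ioi_self).const_mul (Real.exp (c * r))).mono'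
    (measurable_deriv f).aestronglyMeasurable ?_
  filter_upwards [ae_restrict_mem measurableSet_Ioc] with s hs
  refine (hf.abs_deriv_le s hs.1).trans ?_
  have h0 : 0 ≤ H s := (abs_nonneg _).trans (hf.abs_deriv_le s hs.1)
  rw [← mul_assoc, ← Real.exp_add]
  refine le_mul_of_one_le_left h0 (Real.one_le_exp ?_)
  nlinarith [hs.2, hf.nonneg]

theorem integral_deriv (hf : HasLaplaceDominatedDeriv f H c) {r : ℝ} (hr : 0 ≤ r) :
    ∫ s in (0 : ℝ)..r, deriv f s = f r - f 0 :=
  intervalIntegral.integral_eq_sub_of_hasDerivAt_of_le hr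
    (hf.continuousOn.mono Icc_subset_Ici_self)
    (fun s hs => (hf.differentiableAt s hs.1).hasDerivAt) (hf.intervalIntegrable_deriv hr)

/-- Integrate f': for s ≤ r and c ≥ 0 the weight e^{c(r-s)} is at least 1, so the integral of |f'|
over (0,r) is at most e^{cr} times the Laplace integral of H. -/
theorem exists_abs_le (hf : HasLaplaceDominatedDeriv f H c) :
    ∃ A > 0, ∀ s ≥ 0, |f s| ≤ A * Real.exp (c * s) := by
  set J := ∫ s in Ioi (0 : ℝ), Real.exp (-(c * s)) * H s with hJ
  have hJ0 : 0 ≤ J := setIntegral_nonneg measurableSet_Ioi fun s hs =>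
    mul_nonneg (Real.exp_pos _).le ((abs_nonneg _).trans (hf.abs_deriv_le s hs))
  refine ⟨|f 0| + J + 1, by positivity, fun r hr => ?_⟩
  have h1 : |f r - f 0| ≤ Real.exp (c * r) * J := by
    rw [← hf.integral_deriv hr, intervalIntegral.integral_of_le hr, ← Real.norm_eq_abs]
    calc _ ≤ ∫ s in Ioc 0 r, Real.exp (c * r) * (Real.exp (-(c * s)) * H s) := by
          refine norm_integral_le_of_norm_le
            ((hf.integrableOn.mono_set Ioc_subset_Ioi_self).const_mul _) ?_
          filter_upwards [ae_restrict_mem measurableSet_Ioc] with s hs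
          refine (hf.abs_deriv_le s hs.1).trans ?_
          have h0 : 0 ≤ H s := (abs_nonneg _).trans (hf.abs_deriv_le s hs.1)
          rw [← mul_assoc, ← Real.exp_add]
          refine le_mul_of_one_le_left h0 (Real.one_le_exp ?_)
          nlinarith [hs.2, hf.nonneg]
      _ = Real.exp (c * r) * ∫ s in Ioc 0 r, Real.exp (-(c * s)) * H s := integral_const_mul _ _
      _ ≤ _ := by
          gcongr
          refine setIntegral_mono_set hf.integrableOn ?_ (LE.le.eventuallyLE Ioc_subset_Ioi_self)
          filter_upwards [ae_restrict_mem measurableSet_Ioi] with s hs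
          exact mul_nonneg (Real.exp_pos _).le ((abs_nonneg _).trans (hf.abs_deriv_le s hs))
  have h2 : 1 ≤ Real.exp (c * r) := Real.one_le_exp (mul_nonneg hf.nonneg hr)
  have h3 : |f r| ≤ |f r - f 0| + |f 0| := by
    simpa using abs_add_le (f r - f 0) (f 0)
  nlinarith [abs_nonneg (f 0), Real.exp_pos (c * r)]

theorem aestronglyMeasurable (hf : HasLaplaceDominatedDeriv f H c) :
    AEStronglyMeasurable f (volume.restrict (Ioi 0)) :=
  (hf.continuousOn.mono Ioi_subset_Ici_self).aestronglyMeasurable measurableSet_Ioi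

theorem integrableOn_mul_wrightDensity (hf : HasLaplaceDominatedDeriv f H c) {β : ℝ} (hβ : 0 < β)
    (hβ1 : β < 1) {t : ℝ} (ht : 0 < t) :
    IntegrableOn (fun s => f s * wrightDensity β s t) (Ioi 0) := by
  obtain ⟨A, hA0, hA⟩ := hf.exists_abs_le
  obtain ⟨K, hK0, hK⟩ := exists_abs_wrightDensity_le hβ hβ1 (c + 1) ht
  refine integrableOn_mul_of_abs_le_exp (H := fun s => A * Real.exp (c * s)) (c := c + 1) (K := K)
    ?_ hf.aestronglyMeasurable (fun s hs => hA s (le_of_lt hs))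
    (measurable_wrightDensity hβ hβ1 t).aestronglyMeasurable hK
  refine ((integrableOn_exp_neg_mul_Ioi one_pos 0).const_mul A).congr
    (Eventually.of_forall fun s => ?_)
  simp only
  rw [mul_left_comm, ← Real.exp_add]
  ring_nf

theorem integrableOn_deriv_mul (hf : HasLaplaceDominatedDeriv f H c) {w : ℝ → ℝ} {K : ℝ}
    (hwm : AEStronglyMeasurable w (volume.restrict (Ioi 0)))
    (hw : ∀ s > 0, |w s| ≤ K * Real.exp (-(c * s))) :
    IntegrableOn (fun s => deriv f s * w s) (Ioi 0) :=
  integrableOn_mul_of_abs_le_exp hf.integrableOn (measurable_deriv f).aestronglyMeasurable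
    hf.abs_deriv_le hwm hw

end HasLaplaceDominatedDeriv

/-! ### The Wright transform and its Caputo derivative. -/

theorem aestronglyMeasurable_wrightTail_div {β : ℝ} (hβ : 0 < β) (hβ1 : β < 1) {t : ℝ}
    (ht : 0 < t) :
    AEStronglyMeasurable (fun s => wrightTail β (s / t ^ β)) (volume.restrict (Ioi 0)) := by
  refine ContinuousOn.aestronglyMeasurable ?_ measurableSet_Ioi
  refine (continuousOn_wrightTail hβ hβ1).comp (by fun_prop) fun s hs => ?_
  have : 0 < s := hs
  exact (by positivity : 0 ≤ s / t ^ β)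

theorem hasDerivAt_neg_wrightTail_div {β : ℝ} (hβ : 0 < β) (hβ1 : β < 1) {s t : ℝ} (hs : 0 < s)
    (ht : 0 < t) : HasDerivAt (fun s => -wrightTail β (s / t ^ β)) (wrightDensity β s t) s := by
  have h := ((hasDerivAt_wrightTail hβ hβ1 (z := s / t ^ β) (by positivity)).comp s
    ((hasDerivAt_id s).div_const (t ^ β))).fun_neg
  refine h.congr_deriv ?_
  rw [wrightDensity_eq]
  ring

theorem tendsto_wrightTail_div_zero {β : ℝ} (hβ : 0 < β) (hβ1 : β < 1) {t : ℝ} (ht : 0 < t) :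
    Tendsto (fun s => wrightTail β (s / t ^ β)) (𝓝[>] 0) (𝓝 1) := by
  rw [← wrightTail_zero hβ hβ1]
  refine (continuousOn_wrightTail hβ hβ1 0 self_mem_Ici).tendsto.comp ?_
  refine tendsto_nhdsWithin_iff.mpr ⟨?_, ?_⟩
  · have : ContinuousAt (fun s : ℝ => s / t ^ β) 0 := by fun_prop
    have h := this.tendsto
    rw [zero_div] at h
    exact h.mono_left nhdsWithin_le_nhds
  · filter_upwards [self_mem_nhdsWithin] with s hs
    have : 0 < s := hs
    exact (by positivity : 0 ≤ s / t ^ β)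

theorem wrightTransform_of_pos {β : ℝ} (hβ1 : β < 1) (f : ℝ → ℝ) {t : ℝ} (ht : 0 < t) :
    wrightTransform β f t = ∫ s in Ioi (0 : ℝ), f s * wrightDensity β s t := by
  rw [wrightTransform, if_neg]
  push Not
  exact ⟨hβ1.ne, ht.ne'⟩

theorem wrightTransform_zero (β : ℝ) (f : ℝ → ℝ) : wrightTransform β f 0 = f 0 := by
  simp [wrightTransform]

theorem wrightTransform_one (f : ℝ → ℝ) (t : ℝ) : wrightTransform 1 f t = f t := by
  simp [wrightTransform]

namespace HasLaplaceDominatedDeriv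

variable {f H : ℝ → ℝ} {c β : ℝ}

/-- Integration by parts with the antiderivative -`wrightTail` of the density. Total mass 1 produces
f(0), and the decay of the tail beats the growth of f at infinity. Now t occurs only in the tail, so
domination of f' suffices for differentiation in t. -/
theorem wrightTransform_eq (hf : HasLaplaceDominatedDeriv f H c) (hβ : 0 < β) (hβ1 : β < 1) {t : ℝ}
    (ht : 0 < t) :
    wrightTransform β f t = f 0 + ∫ s in Ioi (0 : ℝ), deriv f s * wrightTail β (s / t ^ β) := by
  rw [wrightTransform_of_pos hβ1 f ht]
  obtain ⟨A, hA0, hA⟩ := hf.exists_abs_le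
  obtain ⟨K, hK0, hK⟩ := exists_wrightTail_div_le hβ hβ1 c ht
  obtain ⟨K', hK'0, hK'⟩ := exists_wrightTail_div_le hβ hβ1 (c + 1) ht
  have hint := hf.integrableOn_deriv_mul (aestronglyMeasurable_wrightTail_div hβ hβ1 ht) hK
  have hf0 : Tendsto f (𝓝[>] 0) (𝓝 (f 0)) :=
    (hf.continuousOn 0 self_mem_Ici).tendsto.mono_left (nhdsWithin_mono _ Ioi_subset_Ici_self)
  have h := integral_Ioi_mul_deriv_eq_deriv_mul (a := 0) (u := f)
    (v := fun s => -wrightTail β (s / t ^ β)) (u' := deriv f) (v' := fun s => wrightDensity β s t)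
    (a' := f 0 * -1) (b' := 0) (fun s hs => (hf.differentiableAt s hs).hasDerivAt)
    (fun s hs => hasDerivAt_neg_wrightTail_div hβ hβ1 hs ht)
    (hf.integrableOn_mul_wrightDensity hβ hβ1 ht)
    (by
      refine hint.neg.congr (Eventually.of_forall fun s => ?_)
      simp)
    (hf0.mul (tendsto_wrightTail_div_zero hβ hβ1 ht).neg)
    (by
      refine squeeze_zero_norm' (a := fun s => A * K' * Real.exp (-s)) ?_ ?_
      · filter_upwards [eventually_gt_atTop 0] with s hs
        simp only [Pi.mul_apply]
        rw [norm_mul, norm_neg, Real.norm_eq_abs, Real.norm_eq_abs]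
        calc _ ≤ A * Real.exp (c * s) * (K' * Real.exp (-((c + 1) * s))) := by
              gcongr
              · exact hA s hs.le
              · exact hK' s hs
          _ = A * K' * (Real.exp (c * s) * Real.exp (-((c + 1) * s))) := by ring
          _ = _ := by rw [← Real.exp_add]; ring_nf
      · simpa using Real.tendsto_exp_neg_atTop_nhds_zero.const_mul (A * K'))
  rw [h]
  simp only [mul_neg, integral_neg]
  ring

theorem hasDerivAt_wrightTransform (hf : HasLaplaceDominatedDeriv f H c) (hβ : 0 < β) (hβ1 : β < 1)
    {t : ℝ} (ht : 0 < t) :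
    HasDerivAt (wrightTransform β f)
      (∫ s in Ioi (0 : ℝ), deriv f s * (β * s / t * wrightDensity β s t)) t := by
  obtain ⟨K, hK0, hK⟩ := exists_stable_le hβ hβ1 c ht
  obtain ⟨K', hK'0, hK'⟩ := exists_wrightTail_div_le hβ hβ1 c ht
  have hnb : Ioo (t / 2) (2 * t) ∈ 𝓝 t := Ioo_mem_nhds (by linarith) (by linarith)
  have hmd := measurable_wrightDensity hβ hβ1 t
  have hmf := measurable_deriv f
  have h := (hasDerivAt_integral_of_dominated_loc_of_deriv_le (μ := volume.restrict (Ioi (0 : ℝ)))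
    (F := fun τ s => deriv f s * wrightTail β (s / τ ^ β))
    (F' := fun τ s => deriv f s * (β * s / τ * wrightDensity β s τ))
    (bound := fun s => K * (Real.exp (-(c * s)) * H s)) hnb
    (by
      filter_upwards [lt_mem_nhds ht] with τ hτ
      exact hmf.aestronglyMeasurable.mul (aestronglyMeasurable_wrightTail_div hβ hβ1 hτ))
    (hf.integrableOn_deriv_mul (aestronglyMeasurable_wrightTail_div hβ hβ1 ht) hK')
    (Measurable.aestronglyMeasurable (by fun_prop))
    (by
      filter_upwards [ae_restrict_mem measurableSet_Ioi] with s hs τ hτ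
      rw [norm_mul, Real.norm_eq_abs, Real.norm_eq_abs]
      calc _ ≤ H s * (K * Real.exp (-(c * s))) :=
            mul_le_mul (hf.abs_deriv_le s hs) (hK τ hτ s hs) (abs_nonneg _)
              ((abs_nonneg _).trans (hf.abs_deriv_le s hs))
        _ = _ := by ring)
    (hf.integrableOn.const_mul K)
    (by
      filter_upwards [ae_restrict_mem measurableSet_Ioi] with s hs τ hτ
      exact (hasDerivAt_wrightTail_div_rpow hβ hβ1 hs ((half_pos ht).trans hτ.1)).const_mul _)).2
  refine (h.const_add (f 0)).congr_of_eventuallyEq ?_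
  filter_upwards [lt_mem_nhds ht] with τ hτ
  exact hf.wrightTransform_eq hβ hβ1 hτ

theorem continuousOn_wrightTransform (hf : HasLaplaceDominatedDeriv f H c) (hβ : 0 < β)
    (hβ1 : β < 1) : ContinuousOn (wrightTransform β f) (Ici 0) := by
  intro t ht
  have ht' : 0 ≤ t := ht
  rcases ht'.lt_or_eq with h | rfl
  · exact (hf.hasDerivAt_wrightTransform hβ hβ1 h).continuousAt.continuousWithinAt
  · rw [← continuousWithinAt_Ioi_iff_Ici]
    rw [ContinuousWithinAt, wrightTransform_zero]
    -- As t → 0 the argument s/t^β tends to ∞ and the tail to 0. The tail is antitone and t^β ≤ 1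
    -- for t < 1, so its value at t = 1 is a majorant.
    obtain ⟨K, hK0, hK⟩ := exists_wrightTail_div_le hβ hβ1 c one_pos
    have hlim : Tendsto (fun t => ∫ s in Ioi (0 : ℝ), deriv f s * wrightTail β (s / t ^ β))
        (𝓝[>] 0) (𝓝 (∫ s in Ioi (0 : ℝ), 0)) := by
      refine tendsto_integral_filter_of_dominated_convergence
        (fun s => K * (Real.exp (-(c * s)) * H s)) ?_ ?_ (hf.integrableOn.const_mul K) ?_
      · filter_upwards [self_mem_nhdsWithin] with t ht
        exact (measurable_deriv f).aestronglyMeasurable.mul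
          (aestronglyMeasurable_wrightTail_div hβ hβ1 ht)
      · filter_upwards [Ioo_mem_nhdsGT one_pos] with t ht
        filter_upwards [ae_restrict_mem measurableSet_Ioi] with s hs
        have hs' : 0 < s := hs
        have ht0 : 0 < t := ht.1
        have h1 : t ^ β ≤ 1 := Real.rpow_le_one ht.1.le ht.2.le hβ.le
        have h2 : |wrightTail β (s / t ^ β)| ≤ K * Real.exp (-(c * s)) := by
          rw [abs_of_nonneg (wrightTail_nonneg hβ hβ1 (by positivity))]
          refine le_trans ?_ ((le_abs_self _).trans (hK s hs))
          refine wrightTail_antitoneOn hβ hβ1 (by simpa using hs'.le)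
            (by exact (by positivity : 0 ≤ s / t ^ β)) ?_
          rw [Real.one_rpow]
          gcongr
        rw [norm_mul, Real.norm_eq_abs, Real.norm_eq_abs]
        calc _ ≤ H s * (K * Real.exp (-(c * s))) :=
              mul_le_mul (hf.abs_deriv_le s hs) h2 (abs_nonneg _)
                ((abs_nonneg _).trans (hf.abs_deriv_le s hs))
          _ = _ := by ring
      · filter_upwards [ae_restrict_mem measurableSet_Ioi] with s hs
        simpa [Function.comp_def] using ((wrightTail_tendsto_zero hβ hβ1).comp
          (tendsto_div_rpow_nhdsGT_zero hβ hs)).const_mul (deriv f s)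
    have h2 := hlim.const_add (f 0)
    rw [integral_zero, add_zero] at h2
    refine h2.congr' ?_
    filter_upwards [self_mem_nhdsWithin] with t ht
    exact (hf.wrightTransform_eq hβ hβ1 ht).symm

/-- Fubini for the Abel integral of the derivative of the Wright transform. -/
theorem abel_deriv_wrightTransform (hf : HasLaplaceDominatedDeriv f H c) (hβ : 0 < β)
    (hβ1 : β < 1) {t : ℝ} (ht : 0 < t) :
    IntervalIntegrable (fun τ => (t - τ) ^ (-β) * deriv (wrightTransform β f) τ) volume 0 t ∧
      ∫ τ in (0 : ℝ)..t, (t - τ) ^ (-β) * deriv (wrightTransform β f) τ =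
        Real.Gamma (1 - β) * ∫ s in Ioi (0 : ℝ), deriv f s * wrightDensity β s t := by
  obtain ⟨K, hK0, hK⟩ := exists_abs_wrightDensity_le hβ hβ1 c ht
  have hmM := measurable_wrightM hβ hβ1
  have hmf := measurable_deriv f
  have hΓ := Gamma_one_sub_pos hβ1
  let k : ℝ → ℝ → ℝ := fun τ s => (t - τ) ^ (-β) * (β * s / τ * wrightDensity β s τ)
  let F : ℝ → ℝ → ℝ := fun τ s => deriv f s * k τ s
  have hFm : Measurable (Function.uncurry F) := by
    unfold F k Function.uncurry
    simp_rw [wrightDensity_eq]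
    fun_prop
  have hk0 : ∀ s > 0, ∀ τ ∈ Ioc 0 t, 0 ≤ k τ s := by
    intro s hs τ hτ
    have h1 := wrightDensity_nonneg hβ hβ1 (le_of_lt hs) hτ.1
    have h2 : 0 ≤ t - τ := sub_nonneg.mpr hτ.2
    have h3 := hτ.1
    simp only [k]
    positivity
  have hkeq : ∀ s > 0, ∀ τ ∈ Ioc 0 t, (t - τ) ^ (-β) * stableDensity β s τ = k τ s := by
    intro s hs τ hτ
    simp only [k]
    rw [stableDensity_eq_wrightDensity hβ hβ1 hs hτ.1]
  have hki : ∀ s > 0, IntegrableOn (fun τ => k τ s) (Ioc 0 t) := by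
    intro s hs
    have := intervalIntegrable_abel_stableDensity hβ hβ1 hs t 0 t
    rw [intervalIntegrable_iff_integrableOn_Ioc_of_le ht.le] at this
    exact this.congr_fun (hkeq s hs) measurableSet_Ioc
  have hkint : ∀ s > 0, ∫ τ in Ioc 0 t, k τ s = Real.Gamma (1 - β) * wrightDensity β s t := by
    intro s hs
    have h := integral_sub_rpow_mul_stableDensity hβ hβ1 hs ht
    rw [intervalIntegral.integral_of_le ht.le, setIntegral_congr_fun measurableSet_Ioc (hkeq s hs),
      stableDensity_eq_wrightDensity hβ hβ1 hs ht] at h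
    have hs' : s ≠ 0 := ne_of_gt hs
    rw [h]
    field_simp
  have hFint : Integrable (Function.uncurry F)
      ((volume.restrict (Ioc 0 t)).prod (volume.restrict (Ioi (0 : ℝ)))) := by
    -- The kernel k is nonnegative, so the Abel identity also computes the τ-integral of |F|, and
    -- absolute integrability reduces to that of f' g_β(·;t).
    refine (integrable_prod_iff' hFm.aestronglyMeasurable).mpr ⟨?_, ?_⟩
    · filter_upwards [ae_restrict_mem measurableSet_Ioi] with s hs
      exact (hki s hs).const_mul (deriv f s)
    · have h := ((hf.integrableOn_deriv_mul
        (measurable_wrightDensity hβ hβ1 t).aestronglyMeasurable hK).norm).const_mul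
          (Real.Gamma (1 - β))
      refine h.congr ?_
      filter_upwards [ae_restrict_mem measurableSet_Ioi] with s hs
      have e : ∫ τ in Ioc 0 t, ‖Function.uncurry F (τ, s)‖ = ∫ τ in Ioc 0 t, |deriv f s| * k τ s := by
        refine setIntegral_congr_fun measurableSet_Ioc fun τ hτ => ?_
        simp only [Function.uncurry, F]
        rw [norm_mul, Real.norm_eq_abs, Real.norm_of_nonneg (hk0 s hs τ hτ)]
      rw [e, integral_const_mul, hkint s hs, norm_mul, Real.norm_eq_abs,
        Real.norm_of_nonneg (wrightDensity_nonneg hβ hβ1 (le_of_lt hs) ht)]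
      ring
  have hinner : ∀ τ ∈ Ioc 0 t, ∫ s in Ioi (0 : ℝ), F τ s =
      (t - τ) ^ (-β) * deriv (wrightTransform β f) τ := by
    intro τ hτ
    rw [(hf.hasDerivAt_wrightTransform hβ hβ1 hτ.1).deriv, ← integral_const_mul]
    refine integral_congr_ae (Eventually.of_forall fun s => ?_)
    simp only [F, k]
    ring
  constructor
  · rw [intervalIntegrable_iff_integrableOn_Ioc_of_le ht.le]
    exact IntegrableOn.congr_fun hFint.integral_prod_left hinner measurableSet_Ioc
  · rw [intervalIntegral.integral_of_le ht.le, ← setIntegral_congr_fun measurableSet_Ioc hinner,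
      integral_integral_swap hFint, ← integral_const_mul]
    refine setIntegral_congr_fun measurableSet_Ioi fun s hs => ?_
    simp only [F]
    rw [integral_const_mul, hkint s hs]
    ring

theorem caputoDeriv_wrightTransform (hf : HasLaplaceDominatedDeriv f H c) (hβ : 0 < β)
    (hβ1 : β < 1) {t : ℝ} (ht : 0 < t) :
    caputoDeriv β (wrightTransform β f) t =
      ∫ s in Ioi (0 : ℝ), deriv f s * wrightDensity β s t := by
  rw [caputoDeriv, if_neg hβ1.ne, (hf.abel_deriv_wrightTransform hβ hβ1 ht).2, ← mul_assoc,
    one_div_mul_cancel (Gamma_one_sub_pos hβ1).ne', one_mul]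

theorem caputoDifferentiableAt_wrightTransform (hf : HasLaplaceDominatedDeriv f H c) (hβ : 0 < β)
    (hβ1 : β < 1) {t : ℝ} (ht : 0 < t) : CaputoDifferentiableAt β (wrightTransform β f) t where
  continuousOn := (hf.continuousOn_wrightTransform hβ hβ1).mono Icc_subset_Ici_self
  differentiableAt _ hτ := (hf.hasDerivAt_wrightTransform hβ hβ1 hτ.1).differentiableAt
  integrable _ := (hf.abel_deriv_wrightTransform hβ hβ1 ht).1

end HasLaplaceDominatedDeriv

/-! ### Moments and exponential moments of the Wright density. -/

/-- Makes the Abel integral formula applicable to powers, which gives a recursion for the moments.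
-/
theorem hasLaplaceDominatedDeriv_pow (n : ℕ) :
    HasLaplaceDominatedDeriv (fun s => s ^ (n + 1)) (fun s => ((n : ℝ) + 1) * s ^ n) 1 where
  continuousOn := by fun_prop
  differentiableAt s _ := by fun_prop
  nonneg := zero_le_one
  integrableOn := by
    have h := (integrableOn_rpow_mul_exp_neg_mul (s := n) (b := 1)
      (by have : (0 : ℝ) ≤ n := by positivity
          linarith) one_pos).const_mul ((n : ℝ) + 1)
    refine IntegrableOn.congr_fun h (fun s _ => ?_) measurableSet_Ioi
    simp only [Real.rpow_natCast]
    ring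
  abs_deriv_le s hs := by
    have hs' : 0 < s := hs
    simp only [deriv_pow_field, Nat.cast_add, Nat.cast_one, add_tsub_cancel_right]
    rw [abs_of_nonneg (by positivity)]

theorem hasLaplaceDominatedDeriv_exp {l : ℝ} (hl : 0 ≤ l) :
    HasLaplaceDominatedDeriv (fun s => Real.exp (l * s)) (fun s => l * Real.exp (l * s)) (l + 1) where
  continuousOn := by fun_prop
  differentiableAt s _ := by fun_prop
  nonneg := by positivity
  integrableOn := by
    refine IntegrableOn.congr_fun ((integrableOn_exp_neg_mul_Ioi one_pos 0).const_mul l)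
      (fun s _ => ?_) measurableSet_Ioi
    rw [mul_left_comm, ← Real.exp_add]
    ring_nf
  abs_deriv_le s _ := by
    have h : HasDerivAt (fun s => Real.exp (l * s)) (Real.exp (l * s) * (l * 1)) s :=
      ((hasDerivAt_id s).const_mul l).exp
    rw [h.deriv, abs_of_nonneg (by positivity)]
    linarith

theorem integral_mul_wrightDensity_scale {β : ℝ} (f : ℝ → ℝ) {t : ℝ} (ht : 0 < t) :
    ∫ s in Ioi (0 : ℝ), f s * wrightDensity β s t =
      ∫ z in Ioi (0 : ℝ), f (t ^ β * z) * wrightM β z := by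
  have htβ : 0 < t ^ β := by positivity
  have h := integral_comp_mul_left_Ioi (fun s => f s * wrightDensity β s t) 0 htβ
  rw [mul_zero, smul_eq_mul, eq_inv_mul_iff_mul_eq₀ htβ.ne', ← integral_const_mul] at h
  rw [← h]
  refine integral_congr_ae (Eventually.of_forall fun z => ?_)
  simp only
  rw [wrightDensity_eq, mul_div_cancel_left₀ _ htβ.ne']
  field_simp

theorem integral_one_sub_rpow_mul_rpow {β γ : ℝ} (hβ1 : β < 1) (hγ : 0 < γ) :
    ∫ τ in (0 : ℝ)..1, (1 - τ) ^ (-β) * τ ^ (γ - 1) =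
      Real.Gamma γ * Real.Gamma (1 - β) / Real.Gamma (γ + (1 - β)) := by
  have h := Complex.betaIntegral_eq_Gamma_mul_div (γ : ℂ) ((1 - β : ℝ) : ℂ) (by simpa using hγ)
    (by rw [Complex.ofReal_re]; linarith)
  have e : Complex.betaIntegral γ ((1 - β : ℝ) : ℂ) =
      ((∫ τ in (0 : ℝ)..1, (1 - τ) ^ (-β) * τ ^ (γ - 1) : ℝ) : ℂ) := by
    rw [Complex.betaIntegral, ← intervalIntegral.integral_ofReal]
    refine intervalIntegral.integral_congr fun τ hτ => ?_
    rw [uIcc_of_le zero_le_one] at hτ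
    rw [Complex.ofReal_mul, Complex.ofReal_cpow (sub_nonneg.mpr hτ.2), Complex.ofReal_cpow hτ.1]
    push_cast
    rw [mul_comm, show (1 : ℂ) - β - 1 = -β by ring]
  rw [e, ← Complex.ofReal_add, Complex.Gamma_ofReal, Complex.Gamma_ofReal, Complex.Gamma_ofReal] at h
  exact_mod_cast h

theorem integrableOn_pow_mul_wrightDensity {β : ℝ} (hβ : 0 < β) (hβ1 : β < 1) (n : ℕ) {t : ℝ}
    (ht : 0 < t) : IntegrableOn (fun s => s ^ n * wrightDensity β s t) (Ioi 0) := by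
  have h0 : IntegrableOn (fun s => Real.exp (0 * s) * wrightDensity β s t) (Ioi 0) :=
    (hasLaplaceDominatedDeriv_exp le_rfl).integrableOn_mul_wrightDensity hβ hβ1 ht
  cases n with
  | zero => simpa using h0
  | succ n => exact (hasLaplaceDominatedDeriv_pow n).integrableOn_mul_wrightDensity hβ hβ1 ht

/-- The moments of the Wright density. -/
theorem integral_pow_mul_wrightDensity {β : ℝ} (hβ : 0 < β) (hβ1 : β < 1) (n : ℕ) :
    ∀ t > 0, ∫ s in Ioi (0 : ℝ), s ^ n * wrightDensity β s t =
      n.factorial / Real.Gamma (β * n + 1) * (t ^ β) ^ n := by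
  induction n with
  | zero =>
    intro t ht
    rw [integral_mul_wrightDensity_scale (fun s => s ^ 0) ht]
    have := wrightTail_zero hβ hβ1
    rw [wrightTail] at this
    simp [this]
  | succ n ih =>
    -- By scaling, the moment of order n + 1 is C t^{β(n+1)} with C unknown. The Abel integral of
    -- its derivative at time 1 is C times a beta integral, and also Γ(1-β)(n+1) times the n-th
    -- moment; solve for C.
    have hscale : ∀ t > 0, ∫ s in Ioi (0 : ℝ), s ^ (n + 1) * wrightDensity β s t =
        (∫ z in Ioi (0 : ℝ), z ^ (n + 1) * wrightM β z) * (t ^ β) ^ (n + 1) := by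
      intro t ht
      rw [integral_mul_wrightDensity_scale (fun s => s ^ (n + 1)) ht, mul_comm, ← integral_const_mul]
      refine integral_congr_ae (Eventually.of_forall fun z => ?_)
      simp only
      rw [mul_pow, mul_assoc]
    set C := ∫ z in Ioi (0 : ℝ), z ^ (n + 1) * wrightM β z with hC
    set γ := β * ((n : ℝ) + 1) with hγ
    have hγ0 : 0 < γ := by positivity
    have hf := hasLaplaceDominatedDeriv_pow n
    have hv : ∀ τ > 0, deriv (wrightTransform β fun s => s ^ (n + 1)) τ = C * (γ * τ ^ (γ - 1)) := by
      intro τ hτ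
      have h : HasDerivAt (fun t => C * t ^ γ) (C * (γ * τ ^ (γ - 1))) τ :=
        (Real.hasDerivAt_rpow_const (Or.inl (ne_of_gt hτ))).const_mul C
      refine HasDerivAt.deriv (h.congr_of_eventuallyEq ?_)
      filter_upwards [lt_mem_nhds hτ] with t ht
      rw [wrightTransform_of_pos hβ1 _ ht, hscale t ht, hγ, ← Real.rpow_natCast, ← Real.rpow_mul ht.le]
      push_cast
      rfl
    have habel := (hf.abel_deriv_wrightTransform hβ hβ1 one_pos).2
    have hR : ∫ s in Ioi (0 : ℝ), deriv (fun s : ℝ => s ^ (n + 1)) s * wrightDensity β s 1 =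
        ((n : ℝ) + 1) * (n.factorial / Real.Gamma (β * n + 1)) := by
      have := ih 1 one_pos
      rw [Real.one_rpow, one_pow, mul_one] at this
      rw [← this, ← integral_const_mul]
      refine integral_congr_ae (Eventually.of_forall fun s => ?_)
      simp
      ring
    have hL : ∫ τ in (0 : ℝ)..1, (1 - τ) ^ (-β) * deriv (wrightTransform β fun s => s ^ (n + 1)) τ =
        C * γ * ∫ τ in (0 : ℝ)..1, (1 - τ) ^ (-β) * τ ^ (γ - 1) := by
      rw [← intervalIntegral.integral_const_mul, intervalIntegral.integral_of_le zero_le_one,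
        intervalIntegral.integral_of_le zero_le_one]
      refine setIntegral_congr_fun measurableSet_Ioc fun τ hτ => ?_
      rw [hv τ hτ.1]
      ring
    rw [hR, hL, integral_one_sub_rpow_mul_rpow hβ1 hγ0, show γ + (1 - β) = β * n + 1 by
      rw [hγ]; ring] at habel
    have hΓ := Gamma_one_sub_pos hβ1
    have hΓ2 : 0 < Real.Gamma (β * n + 1) := Real.Gamma_pos_of_pos (by positivity)
    have hΓ3 : 0 < Real.Gamma (γ + 1) := Real.Gamma_pos_of_pos (by positivity)
    have key : C = (n + 1).factorial / Real.Gamma (γ + 1) := by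
      rw [eq_div_iff hΓ3.ne', Real.Gamma_add_one hγ0.ne', Nat.factorial_succ]
      push_cast
      field_simp at habel
      linarith
    intro t ht
    rw [hscale t ht, key, hγ]
    push_cast
    rfl

/-- Keep only the part x > A of the Gamma integral. The parameter A is free, which gives a lower
bound for Γ(βn+1) good enough to dominate the Mittag-Leffler series uniformly in β. -/
theorem rpow_mul_exp_neg_le_Gamma {A y : ℝ} (hA : 0 < A) (hy : 0 ≤ y) :
    A ^ y * Real.exp (-A) ≤ Real.Gamma (y + 1) := by
  rw [Real.Gamma_eq_integral (by linarith), add_sub_cancel_right]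
  have hint : IntegrableOn (fun x : ℝ => Real.exp (-x) * x ^ y) (Ioi 0) := by
    simpa using Real.GammaIntegral_convergent (s := y + 1) (by linarith)
  have hexp : ∫ x in Ioi A, Real.exp (-x) = Real.exp (-A) := integral_exp_neg_Ioi A
  calc A ^ y * Real.exp (-A) = ∫ x in Ioi A, A ^ y * Real.exp (-x) := by
        rw [integral_const_mul, hexp]
    _ ≤ ∫ x in Ioi A, Real.exp (-x) * x ^ y := by
        refine setIntegral_mono_on ?_ (hint.mono_set (Ioi_subset_Ioi hA.le)) measurableSet_Ioi
          fun x hx => ?_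
        · exact (by simpa using integrableOn_exp_neg_mul_Ioi one_pos A :
            IntegrableOn (fun x => Real.exp (-x)) (Ioi A)).const_mul _
        · rw [mul_comm]
          have : A < x := hx
          gcongr
    _ ≤ _ := by
        refine setIntegral_mono_set hint ?_ (LE.le.eventuallyLE (Ioi_subset_Ioi hA.le))
        filter_upwards [ae_restrict_mem measurableSet_Ioi] with x hx
        have : 0 < x := hx
        positivity

theorem mittagLeffler_term_le {β l t : ℝ} (hβ : 1 / 2 ≤ β) (hβ1 : β < 1) (hl : 0 ≤ l) (ht : 0 < t)
    (n : ℕ) :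
    (l * t ^ β) ^ n / Real.Gamma (β * n + 1) ≤
      Real.exp ((2 * (l * max 1 t) + 1) ^ 2) * (1 / 2) ^ n := by
  set m := max 1 t
  have hm : 1 ≤ m := le_max_left _ _
  set B := 2 * (l * m) + 1 with hB
  have hlm : 0 ≤ l * m := by positivity
  have hB1 : 1 ≤ B := by linarith
  have htm : t ^ β ≤ m := by
    calc t ^ β ≤ m ^ β := by
          gcongr; exact le_max_right _ _
      _ ≤ m ^ (1 : ℝ) := Real.rpow_le_rpow_of_exponent_le hm hβ1.le
      _ = m := Real.rpow_one m
  -- With A = B² and β ≥ 1/2 one has A^{βn} ≥ B^n, as B ≥ 1. Since B/2 dominates l t^β, the quotient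
  -- is geometric with ratio 1/2.
  have hG := rpow_mul_exp_neg_le_Gamma (A := B ^ 2) (y := β * n) (by positivity) (by positivity)
  have hBn : B ^ n ≤ (B ^ 2) ^ (β * n) := by
    rw [← Real.rpow_natCast B 2, ← Real.rpow_mul (by positivity), ← Real.rpow_natCast B n]
    refine Real.rpow_le_rpow_of_exponent_le hB1 ?_
    push_cast
    nlinarith [(Nat.cast_nonneg n : (0 : ℝ) ≤ n)]
  have hΓ : B ^ n * Real.exp (-B ^ 2) ≤ Real.Gamma (β * n + 1) := by
    refine le_trans ?_ hG
    gcongr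
  have hpos : 0 < B ^ n * Real.exp (-B ^ 2) := by positivity
  calc (l * t ^ β) ^ n / Real.Gamma (β * n + 1) ≤ (B / 2) ^ n / (B ^ n * Real.exp (-B ^ 2)) := by
        gcongr
        calc l * t ^ β ≤ l * m := by gcongr
          _ ≤ B / 2 := by rw [hB]; linarith
    _ = _ := by
      rw [Real.exp_neg, div_pow, div_pow, one_pow]
      field_simp

/-- The exponential moments of the Wright density are given by the Mittag-Leffler series. -/
theorem integral_exp_mul_wrightDensity {β l t : ℝ} (hβ : 1 / 2 ≤ β) (hβ1 : β < 1) (hl : 0 ≤ l)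
    (ht : 0 < t) :
    ∫ s in Ioi (0 : ℝ), Real.exp (l * s) * wrightDensity β s t =
      ∑' n : ℕ, (l * t ^ β) ^ n / Real.Gamma (β * n + 1) := by
  have hβ0 : 0 < β := by linarith
  let F : ℕ → ℝ → ℝ := fun n s => l ^ n / (n.factorial : ℝ) * (s ^ n * wrightDensity β s t)
  have hFi : ∀ n, Integrable (F n) (volume.restrict (Ioi 0)) := fun n =>
    (integrableOn_pow_mul_wrightDensity hβ0 hβ1 n ht).const_mul _
  have hFI : ∀ n, ∫ s in Ioi (0 : ℝ), F n s = (l * t ^ β) ^ n / Real.Gamma (β * n + 1) := by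
    intro n
    simp only [F]
    rw [integral_const_mul, integral_pow_mul_wrightDensity hβ0 hβ1 n t ht, mul_pow]
    field_simp
  have hFn : ∀ n, ∫ s in Ioi (0 : ℝ), ‖F n s‖ = (l * t ^ β) ^ n / Real.Gamma (β * n + 1) := by
    intro n
    rw [← hFI]
    refine setIntegral_congr_fun measurableSet_Ioi fun s hs => ?_
    have hs' : 0 < s := hs
    have := wrightDensity_nonneg hβ0 hβ1 hs'.le ht
    simp only [F]
    rw [Real.norm_of_nonneg (by positivity)]
  have hsum : Summable fun n => ∫ s in Ioi (0 : ℝ), ‖F n s‖ := by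
    simp_rw [hFn]
    refine Summable.of_nonneg_of_le (fun n => ?_) (mittagLeffler_term_le hβ hβ1 hl ht)
      (summable_geometric_two.mul_left _)
    have : 0 < Real.Gamma (β * n + 1) := Real.Gamma_pos_of_pos (by positivity)
    positivity
  have hS := hasSum_integral_of_summable_integral_norm hFi hsum
  simp_rw [hFI] at hS
  rw [hS.tsum_eq]
  refine setIntegral_congr_fun measurableSet_Ioi fun s _ => ?_
  have h := (NormedSpace.expSeries_div_hasSum_exp (l * s)).mul_right (wrightDensity β s t)
  rw [← Real.exp_eq_exp_ℝ] at h
  rw [← h.tsum_eq]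
  refine tsum_congr fun n => ?_
  simp only [F]
  rw [mul_pow]
  ring

/-! ### The limit β → 1. -/

theorem eventually_half_le_lt_one : ∀ᶠ β : ℝ in 𝓝[<] 1, 1 / 2 ≤ β ∧ β < 1 := by
  filter_upwards [Ioo_mem_nhdsLT (by norm_num : (1 / 2 : ℝ) < 1)] with β hβ
  exact ⟨hβ.1.le, hβ.2⟩

theorem tendsto_integral_exp_mul_wrightDensity {l t : ℝ} (hl : 0 ≤ l) (ht : 0 < t) :
    Tendsto (fun β => ∫ s in Ioi (0 : ℝ), Real.exp (l * s) * wrightDensity β s t) (𝓝[<] 1)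
      (𝓝 (Real.exp (l * t))) := by
  have h : Tendsto (fun β : ℝ => ∑' n : ℕ, (l * t ^ β) ^ n / Real.Gamma (β * n + 1)) (𝓝[<] 1)
      (𝓝 (∑' n : ℕ, (l * t) ^ n / (n.factorial : ℝ))) := by
    refine tendsto_tsum_of_dominated_convergence
      (summable_geometric_two.mul_left (Real.exp ((2 * (l * max 1 t) + 1) ^ 2))) (fun n => ?_) ?_
    · have h1 : ContinuousAt (fun β : ℝ => (l * t ^ β) ^ n / Real.Gamma (β * n + 1)) 1 := by
        have hΓ : 0 < Real.Gamma (1 * n + 1) := Real.Gamma_pos_of_pos (by positivity)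
        have h2 : ContinuousAt Real.Gamma (1 * n + 1) :=
          (Real.differentiableAt_Gamma fun m h => by
            have h5 : (0 : ℝ) < 1 * n + 1 := by positivity
            have h6 : (0 : ℝ) ≤ m := by positivity
            linarith).continuousAt
        have h3 : ContinuousAt (fun β : ℝ => Real.Gamma (β * n + 1)) 1 :=
          ContinuousAt.comp (f := fun β : ℝ => β * n + 1) h2 (by fun_prop)
        refine ContinuousAt.div ?_ h3 hΓ.ne'
        exact ((continuousAt_const.rpow continuousAt_id (Or.inl ht.ne')).const_mul l).pow n
      have h4 := h1.tendsto
      rw [Real.rpow_one, one_mul, Real.Gamma_nat_eq_factorial] at h4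
      exact h4.mono_left nhdsWithin_le_nhds
    · filter_upwards [eventually_half_le_lt_one] with β hβ n
      have hβ0 : 0 < β := by linarith [hβ.1]
      have : 0 < Real.Gamma (β * n + 1) := Real.Gamma_pos_of_pos (by positivity)
      rw [Real.norm_of_nonneg (by positivity)]
      exact mittagLeffler_term_le hβ.1 hβ.2 hl ht n
  have e : ∑' n : ℕ, (l * t) ^ n / (n.factorial : ℝ) = Real.exp (l * t) := by
    have := (NormedSpace.expSeries_div_hasSum_exp (l * t)).tsum_eq
    rw [this, ← Real.exp_eq_exp_ℝ]
  rw [e] at h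
  refine h.congr' ?_
  filter_upwards [eventually_half_le_lt_one] with β hβ
  exact (integral_exp_mul_wrightDensity hβ.1 hβ.2 hl ht).symm

/-- Away from t the test function (e^{ls} - e^{lt})² is at least a multiple of e^{2ls}, so it
controls functions of exponential growth. -/
theorem one_sub_exp_mul_exp_le_abs {l δ s t : ℝ} (hl : 0 < l) (hst : δ ≤ |s - t|) :
    (1 - Real.exp (-(l * δ))) * Real.exp (l * s) ≤ |Real.exp (l * s) - Real.exp (l * t)| := by
  rcases le_total s t with h | h
  · rw [abs_of_nonpos (by linarith)] at hst
    have h1 : Real.exp (l * s) ≤ Real.exp (-(l * δ)) * Real.exp (l * t) := by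
      rw [← Real.exp_add]
      refine Real.exp_le_exp.mpr (by nlinarith)
    have h2 : Real.exp (l * s) ≤ Real.exp (l * t) := Real.exp_le_exp.mpr (by nlinarith)
    rw [abs_of_nonpos (by linarith)]
    by_cases h3 : 0 ≤ 1 - Real.exp (-(l * δ))
    · nlinarith
    · push Not at h3
      nlinarith [Real.exp_pos (l * s)]
  · rw [abs_of_nonneg (by linarith)] at hst
    have h1 : Real.exp (l * t) ≤ Real.exp (-(l * δ)) * Real.exp (l * s) := by
      rw [← Real.exp_add]
      refine Real.exp_le_exp.mpr (by nlinarith)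
    refine le_trans ?_ (le_abs_self _)
    linarith

/-- As `β → 1⁻` the Wright transform converges to the function itself. -/
theorem HasLaplaceDominatedDeriv.tendsto_wrightTransform {f H : ℝ → ℝ} {c : ℝ}
    (hf : HasLaplaceDominatedDeriv f H c) {t : ℝ} (ht : 0 < t) :
    Tendsto (fun β => wrightTransform β f t) (𝓝[<] 1) (𝓝 (f t)) := by
  obtain ⟨A, hA0, hA⟩ := hf.exists_abs_le
  -- The shift by 1 makes l positive even if c = 0; what is needed later is c ≤ 2l.
  set l := c + 1 with hl
  have hl0 : 0 < l := by have := hf.nonneg; linarith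
  let E : ℝ → ℝ → ℝ := fun l β => ∫ s in Ioi (0 : ℝ), Real.exp (l * s) * wrightDensity β s t
  have hE : ∀ l, 0 ≤ l → Tendsto (E l) (𝓝[<] 1) (𝓝 (Real.exp (l * t))) := fun l hl =>
    tendsto_integral_exp_mul_wrightDensity hl ht
  -- Q β is the integral of (e^{ls} - e^{lt})² against g_β(·;t), expanded into exponential moments;
  -- it tends to 0.
  let Q : ℝ → ℝ := fun β => E (2 * l) β - 2 * Real.exp (l * t) * E l β + Real.exp (2 * l * t) * E 0 β
  have hQ : Tendsto Q (𝓝[<] 1) (𝓝 0) := by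
    have h := ((hE (2 * l) (by positivity)).sub ((hE l hl0.le).const_mul
      (2 * Real.exp (l * t)))).add ((hE 0 le_rfl).const_mul (Real.exp (2 * l * t)))
    have e : Real.exp (2 * l * t) - 2 * Real.exp (l * t) * Real.exp (l * t) +
        Real.exp (2 * l * t) * Real.exp (0 * t) = 0 := by
      rw [show 2 * l * t = l * t + l * t by ring, Real.exp_add, zero_mul, Real.exp_zero]
      ring
    rw [e] at h
    exact h
  have hcont : ContinuousAt f t := (hf.differentiableAt t ht).continuousAt
  rw [Metric.tendsto_nhds]
  intro ε hε
  obtain ⟨δ, hδ, hδf⟩ := Metric.continuousAt_iff.mp hcont (ε / 2) (by positivity)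
  set η := 1 - Real.exp (-(l * δ)) with hη
  have hη0 : 0 < η := by
    rw [hη, sub_pos, Real.exp_lt_one_iff]
    have : 0 < l * δ := by positivity
    linarith
  set K := (A + |f t|) / η ^ 2 with hK
  have hK0 : 0 ≤ K := by positivity
  -- Near t use continuity of f; away from t use its growth bound, absorbed by the test function.
  have hptw : ∀ s > 0, |f s - f t| ≤ ε / 2 + K * (Real.exp (l * s) - Real.exp (l * t)) ^ 2 := by
    intro s hs
    rcases lt_or_ge (|s - t|) δ with h | h
    · have h1 := hδf (x := s) (by rwa [Real.dist_eq])
      rw [Real.dist_eq] at h1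
      have : 0 ≤ K * (Real.exp (l * s) - Real.exp (l * t)) ^ 2 := by positivity
      linarith
    · have h1 := one_sub_exp_mul_exp_le_abs (t := t) hl0 h
      have h2 : (η * Real.exp (l * s)) ^ 2 ≤ (Real.exp (l * s) - Real.exp (l * t)) ^ 2 := by
        rw [← sq_abs (Real.exp (l * s) - Real.exp (l * t))]
        gcongr
      have h3 : Real.exp (c * s) ≤ Real.exp (l * s) ^ 2 := by
        rw [← Real.exp_nat_mul]
        refine Real.exp_le_exp.mpr ?_
        have := hf.nonneg
        push_cast
        nlinarith
      have h4 : 1 ≤ Real.exp (c * s) := Real.one_le_exp (mul_nonneg hf.nonneg (le_of_lt hs))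
      have h5 : |f s - f t| ≤ |f s| + |f t| := abs_sub _ _
      calc |f s - f t| ≤ A * Real.exp (c * s) + |f t| * Real.exp (c * s) := by
            have := hA s (le_of_lt hs)
            nlinarith [abs_nonneg (f t)]
        _ = (A + |f t|) * Real.exp (c * s) := by ring
        _ ≤ (A + |f t|) * Real.exp (l * s) ^ 2 := by gcongr
        _ = K * (η * Real.exp (l * s)) ^ 2 := by rw [hK]; field_simp
        _ ≤ K * (Real.exp (l * s) - Real.exp (l * t)) ^ 2 := by gcongr
        _ ≤ _ := by linarith
  have hQK : Tendsto (fun β => K * Q β) (𝓝[<] 1) (𝓝 0) := by simpa using hQ.const_mul K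
  filter_upwards [eventually_half_le_lt_one, hQK.eventually_lt_const (half_pos hε)] with β hβ hQβ
  have hβ0 : 0 < β := by linarith [hβ.1]
  have hβ1 := hβ.2
  have hg1 : ∫ s in Ioi (0 : ℝ), wrightDensity β s t = 1 := by
    have := integral_pow_mul_wrightDensity hβ0 hβ1 0 t ht
    simpa using this
  have hE0 : E 0 β = 1 := by
    simp only [E, zero_mul, Real.exp_zero, one_mul]
    exact hg1
  have hi0 : IntegrableOn (fun s => wrightDensity β s t) (Ioi 0) := by
    simpa using integrableOn_pow_mul_wrightDensity hβ0 hβ1 0 ht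
  have hie : ∀ l, 0 ≤ l → IntegrableOn (fun s => Real.exp (l * s) * wrightDensity β s t) (Ioi 0) :=
    fun l hl => (hasLaplaceDominatedDeriv_exp hl).integrableOn_mul_wrightDensity hβ0 hβ1 ht
  have hif := hf.integrableOn_mul_wrightDensity hβ0 hβ1 ht
  have hdiff : wrightTransform β f t - f t = ∫ s in Ioi (0 : ℝ), (f s - f t) * wrightDensity β s t := by
    simp_rw [sub_mul]
    rw [integral_sub hif (hi0.const_mul _), integral_const_mul, hg1, mul_one,
      wrightTransform_of_pos hβ1 f ht]
  have hmaj : ∀ s, (ε / 2 + K * (Real.exp (l * s) - Real.exp (l * t)) ^ 2) * wrightDensity β s t =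
      ε / 2 * wrightDensity β s t + K * (Real.exp (2 * l * s) * wrightDensity β s t -
        2 * Real.exp (l * t) * (Real.exp (l * s) * wrightDensity β s t) +
        Real.exp (2 * l * t) * wrightDensity β s t) := by
    intro s
    rw [show 2 * l * s = l * s + l * s by ring, show 2 * l * t = l * t + l * t by ring,
      Real.exp_add, Real.exp_add]
    ring
  have hi1 := hie (2 * l) (by positivity)
  have hi2 := (hie l hl0.le).const_mul (2 * Real.exp (l * t))
  have hi3 := hi0.const_mul (Real.exp (2 * l * t))
  have hi12 : IntegrableOn (fun s => Real.exp (2 * l * s) * wrightDensity β s t -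
      2 * Real.exp (l * t) * (Real.exp (l * s) * wrightDensity β s t)) (Ioi 0) := hi1.sub hi2
  have hi4 : IntegrableOn (fun s => K * (Real.exp (2 * l * s) * wrightDensity β s t -
      2 * Real.exp (l * t) * (Real.exp (l * s) * wrightDensity β s t) +
      Real.exp (2 * l * t) * wrightDensity β s t)) (Ioi 0) := (hi12.add hi3).const_mul K
  have hmajint : ∫ s in Ioi (0 : ℝ),
      (ε / 2 + K * (Real.exp (l * s) - Real.exp (l * t)) ^ 2) * wrightDensity β s t =
      ε / 2 + K * Q β := by
    simp_rw [hmaj]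
    rw [integral_add (hi0.const_mul _) hi4, integral_const_mul,
      integral_const_mul, integral_add hi12 hi3, integral_sub hi1 hi2, integral_const_mul,
      integral_const_mul, hg1]
    simp only [Q, hE0, mul_one, E]
  rw [Real.dist_eq, hdiff, ← Real.norm_eq_abs]
  calc _ ≤ ∫ s in Ioi (0 : ℝ),
        (ε / 2 + K * (Real.exp (l * s) - Real.exp (l * t)) ^ 2) * wrightDensity β s t := by
        refine norm_integral_le_of_norm_le ?_ ?_
        · refine ((hi0.const_mul (ε / 2)).add hi4).congr
            (Eventually.of_forall fun s => (hmaj s).symm)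
        · filter_upwards [ae_restrict_mem measurableSet_Ioi] with s hs
          have hg := wrightDensity_nonneg hβ0 hβ1 (le_of_lt hs) ht
          rw [norm_mul, Real.norm_of_nonneg hg, Real.norm_eq_abs]
          exact mul_le_mul_of_nonneg_right (hptw s hs) hg
    _ = ε / 2 + K * Q β := hmajint
    _ < ε := by linarith

/-! ### Differentiation in x and the fractional equation. -/

theorem integrableOn_exp_neg_mul_of_le {c c' : ℝ} {h : ℝ → ℝ} (hcc' : c ≤ c')
    (hh : IntegrableOn (fun s => Real.exp (-c * s) * h s) (Ioi 0)) :
    IntegrableOn (fun s => Real.exp (-(c' * s)) * h s) (Ioi 0) := by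
  have e : ∀ s, Real.exp (-(c' * s)) * h s =
      Real.exp (-((c' - c) * s)) * (Real.exp (-c * s) * h s) := by
    intro s
    rw [← mul_assoc, ← Real.exp_add]
    ring_nf
  simp_rw [e]
  refine hh.norm.mono' (AEStronglyMeasurable.mul (by fun_prop) hh.aestronglyMeasurable) ?_
  filter_upwards [ae_restrict_mem measurableSet_Ioi] with s hs
  have hs' : 0 < s := hs
  rw [norm_mul, Real.norm_of_nonneg (Real.exp_pos _).le]
  refine mul_le_of_le_one_left (norm_nonneg _) (Real.exp_le_one_iff.mpr ?_)
  nlinarith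

/-- A limit of difference quotients along a sequence z → x. Nothing is assumed about the dependence
of u_x and u_xx on s, so their measurability has to come from that of u(z,·) for z near x. -/
theorem aestronglyMeasurable_partialX {F : ℝ → ℝ → ℝ} {x : ℝ}
    (hm : ∀ᶠ z in 𝓝 x, AEStronglyMeasurable (F z) (volume.restrict (Ioi 0)))
    (hd : ∀ s > 0, DifferentiableAt ℝ (fun z => F z s) x) :
    AEStronglyMeasurable (partialX F x) (volume.restrict (Ioi 0)) := by
  obtain ⟨δ, hδ, hball⟩ := Metric.eventually_nhds_iff.mp hm
  let y : ℕ → ℝ := fun n => x + δ / 2 * (1 / ((n : ℝ) + 1))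
  have hypos : ∀ n : ℕ, 0 < δ / 2 * (1 / ((n : ℝ) + 1)) := fun n => by positivity
  have hyδ : ∀ n, dist (y n) x < δ := by
    intro n
    have h1 : 1 / ((n : ℝ) + 1) ≤ 1 := by
      rw [div_le_one (by positivity)]
      have : (0 : ℝ) ≤ n := by positivity
      linarith
    rw [Real.dist_eq, add_sub_cancel_left, abs_of_pos (hypos n)]
    nlinarith
  have hy : Tendsto y atTop (𝓝[≠] x) := by
    refine tendsto_nhdsWithin_iff.mpr ⟨?_, Eventually.of_forall fun n => ?_⟩
    · simpa [y] using (tendsto_one_div_add_atTop_nhds_zero_nat.const_mul (δ / 2)).const_add x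
    · have : x < y n := lt_add_of_pos_right x (hypos n)
      exact this.ne'
  refine aestronglyMeasurable_of_tendsto_ae atTop
    (f := fun n s => (y n - x)⁻¹ * (F (y n) s - F x s)) (fun n => ?_) ?_
  · exact ((hball (hyδ n)).sub (hball (by simpa using hδ))).const_mul _
  · filter_upwards [ae_restrict_mem measurableSet_Ioi] with s hs
    exact (hasDerivAt_iff_tendsto_slope.mp (hd s hs).hasDerivAt).comp hy

/-- Differentiation in `x` under the integral against the Wright density. -/
theorem hasDerivAt_integral_mul_wrightDensity {F : ℝ → ℝ → ℝ} {h : ℝ → ℝ} {x c β t : ℝ}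
    (hβ : 0 < β) (hβ1 : β < 1) (ht : 0 < t)
    (hm : ∀ᶠ z in 𝓝 x, AEStronglyMeasurable (F z) (volume.restrict (Ioi 0)))
    (hd : ∀ᶠ z in 𝓝 x, ∀ s > 0, DifferentiableAt ℝ (fun z => F z s) z)
    (hi : IntegrableOn (fun s => F x s * wrightDensity β s t) (Ioi 0))
    (hh : IntegrableOn (fun s => Real.exp (-c * s) * h s) (Ioi 0))
    (hb : ∀ᶠ z in 𝓝 x, ∀ s > 0, |partialX F z s| ≤ h s) :
    HasDerivAt (fun z => ∫ s in Ioi (0 : ℝ), F z s * wrightDensity β s t)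
      (∫ s in Ioi (0 : ℝ), partialX F x s * wrightDensity β s t) x := by
  obtain ⟨K, hK0, hK⟩ := exists_abs_wrightDensity_le hβ hβ1 c ht
  have hmg := (measurable_wrightDensity hβ hβ1 t).aestronglyMeasurable
    (μ := volume.restrict (Ioi (0 : ℝ)))
  refine (hasDerivAt_integral_of_dominated_loc_of_deriv_le (μ := volume.restrict (Ioi (0 : ℝ)))
    (F := fun z s => F z s * wrightDensity β s t)
    (F' := fun z s => partialX F z s * wrightDensity β s t)
    (bound := fun s => K * (Real.exp (-c * s) * h s)) (hd.and hb) ?_ hi ?_ ?_ (hh.const_mul K) ?_).2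
  · filter_upwards [hm] with z hz using hz.mul hmg
  · exact (aestronglyMeasurable_partialX hm hd.self_of_nhds).mul hmg
  · filter_upwards [ae_restrict_mem measurableSet_Ioi] with s hs z hz
    rw [norm_mul, Real.norm_eq_abs, Real.norm_eq_abs, neg_mul]
    calc _ ≤ h s * (K * Real.exp (-(c * s))) :=
          mul_le_mul (hz.2 s hs) (hK s hs) (abs_nonneg _) ((abs_nonneg _).trans (hz.2 s hs))
      _ = _ := by ring
  · filter_upwards [ae_restrict_mem measurableSet_Ioi] with s hs z hz
    exact (hz.1 s hs).hasDerivAt.mul_const _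

theorem integrableOn_partialX_mul_wrightDensity {F : ℝ → ℝ → ℝ} {h : ℝ → ℝ} {x c β t : ℝ}
    (hβ : 0 < β) (hβ1 : β < 1) (ht : 0 < t)
    (hm : AEStronglyMeasurable (partialX F x) (volume.restrict (Ioi 0)))
    (hh : IntegrableOn (fun s => Real.exp (-c * s) * h s) (Ioi 0))
    (hb : ∀ s > 0, |partialX F x s| ≤ h s) :
    IntegrableOn (fun s => partialX F x s * wrightDensity β s t) (Ioi 0) := by
  obtain ⟨K, -, hK⟩ := exists_abs_wrightDensity_le hβ hβ1 c ht
  exact integrableOn_mul_of_abs_le_exp (by simpa using hh) hm hb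
    (measurable_wrightDensity hβ hβ1 t).aestronglyMeasurable hK

namespace IsClassicalSolution

variable {I : Set ℝ} {σ μ : ℝ → ℝ} {u : ℝ → ℝ → ℝ}

/-- The equation itself dominates u_t: at fixed x the coefficients are constants, so |σ(x)| h₂ +
|μ(x)| h₁ is a bound. The abscissa is enlarged to be common to both and nonnegative. -/
theorem exists_hasLaplaceDominatedDeriv (hu : IsClassicalSolution I σ μ u)
    (hux : LocallyLaplaceDominated I (partialX u))
    (huxx : LocallyLaplaceDominated I (partialXX u)) {x : ℝ} (hx : x ∈ I) :
    ∃ H c, HasLaplaceDominatedDeriv (u x) H c := by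
  obtain ⟨c₁, h₁, hi₁, hb₁⟩ := hux x hx
  obtain ⟨c₂, h₂, hi₂, hb₂⟩ := huxx x hx
  set c := max (max c₁ c₂) 0
  have hc₁ : c₁ ≤ c := (le_max_left _ _).trans (le_max_left _ _)
  have hc₂ : c₂ ≤ c := (le_max_right _ _).trans (le_max_left _ _)
  refine ⟨fun s => |σ x| * h₂ s + |μ x| * h₁ s, c, hu.continuousOn x hx,
    hu.differentiableAt_t x hx, le_max_right _ _, ?_, fun s hs => ?_⟩
  · refine (((integrableOn_exp_neg_mul_of_le hc₂ hi₂).const_mul |σ x|).add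
      ((integrableOn_exp_neg_mul_of_le hc₁ hi₁).const_mul |μ x|)).congr
        (Eventually.of_forall fun s => ?_)
    simp only [Pi.add_apply]
    ring
  · rw [hu.equation x hx s hs]
    refine (abs_add_le _ _).trans ?_
    rw [abs_mul, abs_mul]
    have := hb₁.self_of_nhds s hs
    have := hb₂.self_of_nhds s hs
    gcongr

theorem aestronglyMeasurable (hu : IsClassicalSolution I σ μ u) {x : ℝ} (hx : x ∈ I) :
    AEStronglyMeasurable (u x) (volume.restrict (Ioi 0)) :=
  ((hu.continuousOn x hx).mono Ioi_subset_Ici_self).aestronglyMeasurable measurableSet_Ioi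

/-- The Caputo derivative of u_β and its first two x-derivatives are the integrals of u_t, u_x and
u_xx against the same density, so the classical equation is integrated pointwise in s. -/
theorem isFractionalSolution_wrightTransform (hI : IsOpen I) (hu : IsClassicalSolution I σ μ u)
    (hux : LocallyLaplaceDominated I (partialX u))
    (huxx : LocallyLaplaceDominated I (partialXX u)) {β : ℝ} (hβ : 0 < β) (hβ1 : β < 1) :
    IsFractionalSolution β I σ μ (fun x t => wrightTransform β (u x) t) := by
  have hD := fun {x : ℝ} (hx : x ∈ I) => hu.exists_hasLaplaceDominatedDeriv hux huxx hx
  have hmux : ∀ x ∈ I, AEStronglyMeasurable (partialX u x) (volume.restrict (Ioi 0)) := by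
    intro x hx
    refine aestronglyMeasurable_partialX ?_ (hu.differentiableAt_x x hx)
    filter_upwards [hI.mem_nhds hx] with z hz using hu.aestronglyMeasurable hz
  have hmuxx : ∀ x ∈ I, AEStronglyMeasurable (partialXX u x) (volume.restrict (Ioi 0)) := by
    intro x hx
    refine aestronglyMeasurable_partialX (F := partialX u) ?_ (hu.differentiableAt_xx x hx)
    filter_upwards [hI.mem_nhds hx] with z hz using hmux z hz
  have hi₁ : ∀ x ∈ I, ∀ t > 0,
      IntegrableOn (fun s => partialX u x s * wrightDensity β s t) (Ioi 0) := by
    intro x hx t ht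
    obtain ⟨c, h, hi, hb⟩ := hux x hx
    exact integrableOn_partialX_mul_wrightDensity hβ hβ1 ht (hmux x hx) hi hb.self_of_nhds
  have hi₂ : ∀ x ∈ I, ∀ t > 0,
      IntegrableOn (fun s => partialXX u x s * wrightDensity β s t) (Ioi 0) := by
    intro x hx t ht
    obtain ⟨c, h, hi, hb⟩ := huxx x hx
    exact integrableOn_partialX_mul_wrightDensity (F := partialX u) hβ hβ1 ht (hmuxx x hx) hi
      hb.self_of_nhds
  have hx₁ : ∀ x ∈ I, ∀ t > 0, HasDerivAt (fun z => wrightTransform β (u z) t)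
      (∫ s in Ioi (0 : ℝ), partialX u x s * wrightDensity β s t) x := by
    intro x hx t ht
    obtain ⟨c, h, hi, hb⟩ := hux x hx
    obtain ⟨H, c', hf⟩ := hD hx
    simp_rw [wrightTransform_of_pos hβ1 _ ht]
    refine hasDerivAt_integral_mul_wrightDensity hβ hβ1 ht ?_ ?_
      (hf.integrableOn_mul_wrightDensity hβ hβ1 ht) hi hb
    · filter_upwards [hI.mem_nhds hx] with z hz using hu.aestronglyMeasurable hz
    · filter_upwards [hI.mem_nhds hx] with z hz using hu.differentiableAt_x z hz
  have hpx : ∀ x ∈ I, ∀ t > 0, partialX (fun x t => wrightTransform β (u x) t) x t =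
      ∫ s in Ioi (0 : ℝ), partialX u x s * wrightDensity β s t := fun x hx t ht =>
    (hx₁ x hx t ht).deriv
  have hx₂ : ∀ x ∈ I, ∀ t > 0,
      HasDerivAt (fun z => partialX (fun x t => wrightTransform β (u x) t) z t)
        (∫ s in Ioi (0 : ℝ), partialXX u x s * wrightDensity β s t) x := by
    intro x hx t ht
    obtain ⟨c, h, hi, hb⟩ := huxx x hx
    have h := hasDerivAt_integral_mul_wrightDensity (F := partialX u) hβ hβ1 ht
      (by filter_upwards [hI.mem_nhds hx] with z hz using hmux z hz)
      (by filter_upwards [hI.mem_nhds hx] with z hz using hu.differentiableAt_xx z hz)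
      (hi₁ x hx t ht) hi hb
    refine h.congr_of_eventuallyEq ?_
    filter_upwards [hI.mem_nhds hx] with z hz using hpx z hz t ht
  refine ⟨fun x hx => ?_, fun x hx t ht => ?_, fun x hx t ht => (hx₁ x hx t ht).differentiableAt,
    fun x hx t ht => (hx₂ x hx t ht).differentiableAt, fun x hx t ht => ?_⟩
  · obtain ⟨H, c, hf⟩ := hD hx
    exact hf.continuousOn_wrightTransform hβ hβ1
  · obtain ⟨H, c, hf⟩ := hD hx
    exact hf.caputoDifferentiableAt_wrightTransform hβ hβ1 ht
  · obtain ⟨H, c, hf⟩ := hD hx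
    have hxx : partialXX (fun x t => wrightTransform β (u x) t) x t =
        ∫ s in Ioi (0 : ℝ), partialXX u x s * wrightDensity β s t := (hx₂ x hx t ht).deriv
    rw [hpx x hx t ht, hxx, ← integral_const_mul, ← integral_const_mul,
      ← integral_add ((hi₂ x hx t ht).const_mul _) ((hi₁ x hx t ht).const_mul _)]
    refine (hf.caputoDeriv_wrightTransform hβ hβ1 ht).trans ?_
    refine setIntegral_congr_fun measurableSet_Ioi fun s hs => ?_
    simp only [hu.equation x hx s hs]
    ring

theorem isFractionalSolution_one (hu : IsClassicalSolution I σ μ u) :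
    IsFractionalSolution 1 I σ μ u where
  continuousOn := hu.continuousOn
  caputoDifferentiableAt_t x hx _ _ :=
    ⟨(hu.continuousOn x hx).mono Icc_subset_Ici_self,
      fun τ hτ => hu.differentiableAt_t x hx τ hτ.1, fun h => absurd rfl h⟩
  differentiableAt_x := hu.differentiableAt_x
  differentiableAt_xx := hu.differentiableAt_xx
  equation x hx t ht := by
    rw [caputoDeriv, if_pos rfl]
    exact hu.equation x hx t ht

end IsClassicalSolution

end

theorem theorem4p1 (I : Set ℝ) (hI : IsOpen I) (σ μ : ℝ → ℝ) (u : ℝ → ℝ → ℝ)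
    (hu : IsClassicalSolution I σ μ u)
    (hux : LocallyLaplaceDominated I (partialX u))
    (huxx : LocallyLaplaceDominated I (partialXX u)) :
    (∀ β : ℝ, 0 < β → β < 1 → ∀ x ∈ I, ∀ t > 0,
      IntegrableOn (fun s => u x s * wrightDensity β s t) (Ioi 0)) ∧
    (∀ β : ℝ, 0 < β → β ≤ 1 →
      IsFractionalSolution β I σ μ (fun x t => wrightTransform β (u x) t) ∧
      ∀ x ∈ I, wrightTransform β (u x) 0 = u x 0) ∧
    (∀ x ∈ I, ∀ t ≥ 0,
      Tendsto (fun β : ℝ => wrightTransform β (u x) t) (𝓝[<] 1) (𝓝 (u x t))) := by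
  refine ⟨fun β hβ hβ1 x hx t ht => ?_, fun β hβ hβ1 => ⟨?_, fun x _ => wrightTransform_zero β _⟩,
    fun x hx t ht => ?_⟩
  · obtain ⟨H, c, hf⟩ := hu.exists_hasLaplaceDominatedDeriv hux huxx hx
    exact hf.integrableOn_mul_wrightDensity hβ hβ1 ht
  · rcases hβ1.lt_or_eq with h | rfl
    · exact hu.isFractionalSolution_wrightTransform hI hux huxx hβ h
    · simp_rw [wrightTransform_one]
      exact hu.isFractionalSolution_one
  · obtain ⟨H, c, hf⟩ := hu.exists_hasLaplaceDominatedDeriv hux huxx hx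
    rcases ht.lt_or_eq with h | rfl
    · exact hf.tendsto_wrightTransform h
    · simp_rw [wrightTransform_zero]
      exact tendsto_const_nhds
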